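/- Let $n>0$ be an integer and let $S^2\subset\mathbb{R}^3$ be the round unit sphere. Let $M_n\subset\mathbb{CP}^{2n+1}$ be the set of points $[a_1:\dots:a_{2n+2}]$ such that $a_{n+1}$ and $a_{2n+2}$ do not both vanish and the polynomials $a_1+a_2z+\dots+a_{n+1}z^n$ and $a_{n+2}+a_{n+3}z+\dots+a_{2n+2}z^n$ have no common root in $\mathbb{C}$. It is an open subset, and we give it the induced complex structure. A point of $M_n$ is identified with the degree $n$ rational map $\varphi:S^2\to S^2$ which in stereographic coordinates on domain and codomain is $$W(z)=\frac{a_1+a_2z+\dots+a_{n+1}z^n}{a_{n+2}+a_{n+3}z+\dots+a_{2n+2}z^n}.$$ For $X\in T_\varphi M_n$ and $p\in S^2$ let $X(p)\in T_{\varphi(p)}S^2\subset\mathbb{R}^3$ be the derivative at $\varphi$ in the direction $X$ of the evaluation map $M_n\to S^2\subset\mathbb{R}^3$, $\psi\mapsto\psi(p)$. The $L^2$ metric on $M_n$ is $$\gamma_\varphi(X,Y)=\int_{S^2}\langle X(p),Y(p)\rangle\,d\mu(p),\qquad X,Y\in T_\varphi M_n,$$ where $\mu$ is the area measure of $S^2$.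 Then the evaluation maps are smooth, the integrals converge, and $\gamma$ is a Kähler metric on the complex manifold $M_n$: it is a smooth Riemannian metric, it is Hermitian, $\gamma(JX,JY)=\gamma(X,Y)$, where $J$ is the complex structure of $M_n$, and the 2-form $\Omega(X,Y)=\gamma(JX,Y)$ is closed. -/

import Mathlib

open Complex MeasureTheory Metric Bundle Set
open scoped Manifold ContDiff LinearAlgebra.Projectivization

noncomputable section

namespace RatMap

/-! ### Complex projective space as a complex manifold -/

/-- Complex projective space of complex dimension `N`. -/
abbrev CP (N : ℕ) : Type := ℙ ℂ (Fin (N + 1) → ℂ)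

/-- The projection of the nonzero vectors onto projective space. -/
def proj (N : ℕ) (a : {a : Fin (N + 1) → ℂ // a ≠ 0}) : CP N := Projectivization.mk' ℂ a

/-- The quotient topology. -/
instance instTopologicalSpaceCP (N : ℕ) : TopologicalSpace (CP N) :=
  TopologicalSpace.coinduced (proj N) inferInstance

theorem isQuotientMap_proj (N : ℕ) : Topology.IsQuotientMap (proj N) :=
  ⟨⟨rfl⟩, fun x => by
    induction x using Projectivization.ind with
    | h v hv => exact ⟨⟨v, hv⟩, rfl⟩⟩

/-- A condition on nonzero vectors that is invariant under rescaling, as a set in `CP N`. -/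
def condSet {N : ℕ} (P : (Fin (N + 1) → ℂ) → Prop)
    (hP : ∀ (t : ℂ) (a : Fin (N + 1) → ℂ), t ≠ 0 → (P (t • a) ↔ P a)) : Set (CP N) :=
  {x | Projectivization.lift (fun a : {a : Fin (N + 1) → ℂ // a ≠ 0} => P a) (by
    rintro ⟨a, ha⟩ ⟨b, hb⟩ t (rfl : a = t • b)
    exact propext (hP t b (by rintro rfl; simp at ha))) x}

theorem isOpen_condSet {N : ℕ} {P : (Fin (N + 1) → ℂ) → Prop}
    {hP : ∀ (t : ℂ) (a : Fin (N + 1) → ℂ), t ≠ 0 → (P (t • a) ↔ P a)}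
    (h : IsOpen {a : {a : Fin (N + 1) → ℂ // a ≠ 0} | P a}) : IsOpen (condSet P hP) :=
  (isQuotientMap_proj N).isOpen_preimage.mp h

/-- The set of points whose `i`-th homogeneous coordinate does not vanish. -/
def affineSet {N : ℕ} (i : Fin (N + 1)) : Set (CP N) :=
  condSet (fun a => a i ≠ 0) (fun t a ht => by simp [ht])

theorem isOpen_affineSet {N : ℕ} (i : Fin (N + 1)) : IsOpen (affineSet i) :=
  isOpen_condSet
    (isOpen_ne_fun ((continuous_apply i).comp continuous_subtype_val) continuous_const)

/-- The affine coordinates `a_j / a_i`, `j ≠ i`. -/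
def affineCoord {N : ℕ} (i : Fin (N + 1)) (x : CP N) : Fin N → ℂ :=
  Projectivization.lift
    (fun (a : {a : Fin (N + 1) → ℂ // a ≠ 0}) (j : Fin N) => a.1 (i.succAbove j) / a.1 i) (by
    rintro ⟨a, ha⟩ ⟨b, hb⟩ t (rfl : a = t • b)
    have ht : t ≠ 0 := by rintro rfl; simp at ha
    funext j
    simp [mul_div_mul_left _ _ ht]) x

/-- The vector with `i`-th entry `1` and the other entries `b`. -/
def insertOne {N : ℕ} (i : Fin (N + 1)) (b : Fin N → ℂ) : {a : Fin (N + 1) → ℂ // a ≠ 0} :=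
  ⟨Fin.insertNth (α := fun _ => ℂ) i 1 b, fun h => by
    have := congrFun h i
    simp at this⟩

theorem continuous_insertOne {N : ℕ} (i : Fin (N + 1)) : Continuous (insertOne i) := by
  refine Continuous.subtype_mk (continuous_pi fun j => ?_) _
  rcases Fin.eq_self_or_eq_succAbove i j with rfl | ⟨k, rfl⟩
  · simpa using continuous_const
  · simpa using continuous_apply k

/-- The affine chart `[a] ↦ (a_j / a_i)_{j ≠ i}` of projective space. -/
def affineChart {N : ℕ} (i : Fin (N + 1)) : OpenPartialHomeomorph (CP N) (Fin N → ℂ) where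
  toFun := affineCoord i
  invFun b := proj N (insertOne i b)
  source := affineSet i
  target := univ
  map_source' _ _ := mem_univ _
  map_target' b _ := by
    change Fin.insertNth (α := fun _ => ℂ) i 1 b i ≠ 0
    simp
  left_inv' x := by
    induction x using Projectivization.ind with
    | h a ha =>
      intro (h : a i ≠ 0)
      refine (Projectivization.mk_eq_mk_iff' ℂ _ _ _ _).mpr ⟨(a i)⁻¹, ?_⟩
      funext j
      rcases Fin.eq_self_or_eq_succAbove i j with rfl | ⟨k, rfl⟩
      · simp [h]
      · simp [affineCoord, div_eq_inv_mul]
  right_inv' b _ := by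
    funext j
    change Fin.insertNth (α := fun _ => ℂ) i 1 b (i.succAbove j) /
      Fin.insertNth (α := fun _ => ℂ) i 1 b i = b j
    simp
  open_source := isOpen_affineSet i
  open_target := isOpen_univ
  continuousOn_toFun := by
    rw [(isQuotientMap_proj N).continuousOn_isOpen_iff (isOpen_affineSet i)]
    refine continuousOn_pi.mpr fun j => ?_
    refine ContinuousOn.div (f := fun a : {a : Fin (N + 1) → ℂ // a ≠ 0} => a.1 (i.succAbove j))
      (g := fun a => a.1 i)
      ((continuous_apply _).comp continuous_subtype_val).continuousOn
      ((continuous_apply _).comp continuous_subtype_val).continuousOn ?_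
    intro a ha
    exact ha
  continuousOn_invFun :=
    ((isQuotientMap_proj N).continuous.comp (continuous_insertOne i)).continuousOn

theorem exists_mem_affineSet {N : ℕ} (x : CP N) : ∃ i, x ∈ affineSet i := by
  induction x using Projectivization.ind with
  | h a ha => exact Function.ne_iff.mp ha

instance instChartedSpaceCP (N : ℕ) : ChartedSpace (Fin N → ℂ) (CP N) where
  atlas := range affineChart
  chartAt x := affineChart (exists_mem_affineSet x).choose
  mem_chart_source x := (exists_mem_affineSet x).choose_spec
  chart_mem_atlas _ := mem_range_self _

theorem contDiffOn_affineChart_transition {N : ℕ} (i k : Fin (N + 1)) :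
    ContDiffOn ℂ ω (affineChart k ∘ (affineChart i).symm)
      ((affineChart i).symm.trans (affineChart k)).source := by
  have hc : ∀ j : Fin (N + 1), ContDiff ℂ ω (fun b : Fin N → ℂ => (insertOne i b).1 j) := by
    intro j
    rcases Fin.eq_self_or_eq_succAbove i j with rfl | ⟨l, rfl⟩
    · simpa [insertOne] using contDiff_const
    · simpa [insertOne] using contDiff_apply ℂ ℂ l
  refine contDiffOn_pi.mpr fun j => ?_
  refine ContDiffOn.div (hc (k.succAbove j)).contDiffOn (hc k).contDiffOn ?_
  intro b hb
  exact hb.2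

/-- Projective space is a complex manifold. -/
instance instIsManifoldCP (N : ℕ) : IsManifold 𝓘(ℂ, Fin N → ℂ) ω (CP N) := by
  refine isManifold_of_contDiffOn _ _ _ ?_
  rintro _ _ ⟨i, rfl⟩ ⟨k, rfl⟩
  simpa using contDiffOn_affineChart_transition i k

/-- The underlying real manifold, with the same charts. -/
instance instIsManifoldRealCP (N : ℕ) : IsManifold 𝓘(ℝ, Fin N → ℂ) ω (CP N) := by
  refine isManifold_of_contDiffOn _ _ _ ?_
  rintro _ _ ⟨i, rfl⟩ ⟨k, rfl⟩
  simpa using (contDiffOn_affineChart_transition i k).restrict_scalars ℝ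

/-! ### Kähler metrics on complex manifolds -/

section Kaehler

variable {E : Type*} [NormedAddCommGroup E] [NormedSpace ℂ E] [NormedSpace ℝ E]
  [IsScalarTower ℝ ℂ E] {M : Type*} [TopologicalSpace M] [ChartedSpace E M]

/-- The almost complex structure of a complex manifold: multiplication by `i` on each tangent
space. (A tangent vector at `x` is represented by its coordinates in the preferred chart at `x`;
transition maps being holomorphic, any other chart gives the same operator.) -/
def J (x : M) : TangentSpace 𝓘(ℝ, E) x →L[ℝ] TangentSpace 𝓘(ℝ, E) x :=
  ((Complex.I • ContinuousLinearMap.id ℂ E).restrictScalars ℝ : E →L[ℝ] E)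

/-- A smooth Riemannian metric `g` on a complex manifold is Kähler if it is Hermitian,
`g(JX, JY) = g(X, Y)`, and its fundamental form `Ω(X, Y) = g(JX, Y)` is a closed 2-form, i.e.
in every chart `e` of the atlas the coordinate expression of `Ω` (its pullback under `e⁻¹`)
has vanishing exterior derivative. -/
structure IsKaehler [IsManifold 𝓘(ℝ, E) ∞ M] [IsManifold 𝓘(ℂ, E) ω M]
    (g : ContMDiffRiemannianMetric 𝓘(ℝ, E) ∞ E (fun x : M => TangentSpace 𝓘(ℝ, E) x)) :
    Prop where
  hermitian : ∀ (x : M) (X Y : TangentSpace 𝓘(ℝ, E) x),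
    g.inner x (J x X) (J x Y) = g.inner x X Y
  closed : ∀ e ∈ atlas E M, ∃ Ω : E → E [⋀^Fin 2]→L[ℝ] ℝ,
    (∀ y ∈ e.target, ∀ v w : E, Ω y ![v, w] =
      g.inner (e.symm y) (J (e.symm y) (mfderiv 𝓘(ℝ, E) 𝓘(ℝ, E) e.symm y v))
        (mfderiv 𝓘(ℝ, E) 𝓘(ℝ, E) e.symm y w)) ∧
    ∀ y ∈ e.target, extDeriv Ω y = 0

end Kaehler

/-! ### The space of rational maps of degree `n` -/

/-- The homogenised numerator `∑ₖ aₖ zᵏ wⁿ⁻ᵏ`, `0 ≤ k ≤ n`, which at `w = 1` is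
`a₀ + a₁ z + ⋯ + aₙ zⁿ`. -/
def num {n : ℕ} (a : Fin (2 * n + 1 + 1) → ℂ) (z w : ℂ) : ℂ :=
  ∑ k : Fin (n + 1), a ⟨k, by omega⟩ * z ^ (k : ℕ) * w ^ (n - k)

/-- The homogenised denominator `∑ₖ aₙ₊₁₊ₖ zᵏ wⁿ⁻ᵏ`, `0 ≤ k ≤ n`, which at `w = 1` is
`aₙ₊₁ + aₙ₊₂ z + ⋯ + a₂ₙ₊₁ zⁿ`. -/
def den {n : ℕ} (a : Fin (2 * n + 1 + 1) → ℂ) (z w : ℂ) : ℂ :=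
  ∑ k : Fin (n + 1), a ⟨n + 1 + k, by omega⟩ * z ^ (k : ℕ) * w ^ (n - k)

/-- The coefficient vector `a` defines a rational map of degree `n`: the coefficients of `zⁿ` in
numerator and denominator do not both vanish, and numerator and denominator have no common
root. -/
def IsDegree {n : ℕ} (a : Fin (2 * n + 1 + 1) → ℂ) : Prop :=
  (a ⟨n, by omega⟩ ≠ 0 ∨ a ⟨2 * n + 1, by omega⟩ ≠ 0) ∧ ∀ z : ℂ, ¬(num a z 1 = 0 ∧ den a z 1 = 0)

theorem num_smul {n : ℕ} (t : ℂ) (a : Fin (2 * n + 1 + 1) → ℂ) (z w : ℂ) :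
    num (t • a) z w = t * num a z w := by
  simp [num, Finset.mul_sum, mul_assoc]

theorem den_smul {n : ℕ} (t : ℂ) (a : Fin (2 * n + 1 + 1) → ℂ) (z w : ℂ) :
    den (t • a) z w = t * den a z w := by
  simp [den, Finset.mul_sum, mul_assoc]

theorem num_scale {n : ℕ} (a : Fin (2 * n + 1 + 1) → ℂ) (c z w : ℂ) :
    num a (c * z) (c * w) = c ^ n * num a z w := by
  simp only [num, Finset.mul_sum]
  refine Finset.sum_congr rfl fun k _ => ?_
  have : c ^ n = c ^ (k : ℕ) * c ^ (n - k) := by rw [← pow_add]; congr 1; omega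
  rw [this, mul_pow, mul_pow]; ring

theorem den_scale {n : ℕ} (a : Fin (2 * n + 1 + 1) → ℂ) (c z w : ℂ) :
    den a (c * z) (c * w) = c ^ n * den a z w := by
  simp only [den, Finset.mul_sum]
  refine Finset.sum_congr rfl fun k _ => ?_
  have : c ^ n = c ^ (k : ℕ) * c ^ (n - k) := by rw [← pow_add]; congr 1; omega
  rw [this, mul_pow, mul_pow]; ring

theorem num_one_zero {n : ℕ} (a : Fin (2 * n + 1 + 1) → ℂ) :
    num a 1 0 = a ⟨n, by omega⟩ := by
  rw [num, Fin.sum_univ_castSucc, Finset.sum_eq_zero]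
  · simp
  · intro k _
    have : n - (k : ℕ) ≠ 0 := by omega
    simp [this]

theorem den_one_zero {n : ℕ} (a : Fin (2 * n + 1 + 1) → ℂ) :
    den a 1 0 = a ⟨2 * n + 1, by omega⟩ := by
  rw [den, Fin.sum_univ_castSucc, Finset.sum_eq_zero]
  · simp only [Fin.val_last, one_pow, mul_one, Nat.sub_self, pow_zero, zero_add]
    congr 2
    omega
  · intro k _
    have : n - (k : ℕ) ≠ 0 := by omega
    simp [this]

/-- Equivalently, the homogenised numerator and denominator have no common zero besides
`(0, 0)`. -/
theorem isDegree_iff {n : ℕ} (a : Fin (2 * n + 1 + 1) → ℂ) :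
    IsDegree a ↔ ∀ z w : ℂ, (z ≠ 0 ∨ w ≠ 0) → (num a z w ≠ 0 ∨ den a z w ≠ 0) := by
  constructor
  · rintro ⟨h1, h2⟩ z w hzw
    by_cases hw : w = 0
    · subst hw
      have hz : z ≠ 0 := by simpa using hzw
      have e1 := num_scale a z 1 0
      have e2 := den_scale a z 1 0
      rw [mul_one, mul_zero, num_one_zero] at e1
      rw [mul_one, mul_zero, den_one_zero] at e2
      rw [e1, e2]
      simpa [hz] using h1
    · have e1 := num_scale a w (z / w) 1
      have e2 := den_scale a w (z / w) 1
      rw [mul_one, mul_div_cancel₀ _ hw] at e1 e2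
      rw [e1, e2]
      have := h2 (z / w)
      simp only [mul_ne_zero_iff, ne_eq, pow_eq_zero_iff', hw, false_and, not_false_eq_true,
        true_and]
      tauto
  · intro h
    refine ⟨?_, fun z hz => ?_⟩
    · have := h 1 0 (by simp)
      rwa [num_one_zero, den_one_zero] at this
    · have := h z 1 (by simp)
      tauto

theorem isDegree_smul {n : ℕ} (t : ℂ) (a : Fin (2 * n + 1 + 1) → ℂ) (ht : t ≠ 0) :
    IsDegree (t • a) ↔ IsDegree a := by
  simp [IsDegree, num_smul, den_smul, ht]

theorem isOpen_isDegree (n : ℕ) : IsOpen {a : Fin (2 * n + 1 + 1) → ℂ | IsDegree a} := by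
  have key : {a : Fin (2 * n + 1 + 1) → ℂ | IsDegree a}ᶜ = Prod.snd ''
      {q : sphere (0 : ℂ × ℂ) 1 × (Fin (2 * n + 1 + 1) → ℂ) |
        num q.2 q.1.1.1 q.1.1.2 = 0 ∧ den q.2 q.1.1.1 q.1.1.2 = 0} := by
    ext a
    simp only [mem_compl_iff, mem_ofPred_eq, isDegree_iff, mem_image, Prod.exists,
      exists_eq_right]
    constructor
    · intro h
      push Not at h
      obtain ⟨z, w, hzw, h1, h2⟩ := h
      have hne : ((z, w) : ℂ × ℂ) ≠ 0 := by
        rintro h0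
        rw [Prod.mk_eq_zero] at h0
        tauto
      set r : ℂ := ((‖((z, w) : ℂ × ℂ)‖⁻¹ : ℝ) : ℂ) with hr
      have hmem : ((r * z, r * w) : ℂ × ℂ) ∈ sphere (0 : ℂ × ℂ) 1 := by
        have : ((r * z, r * w) : ℂ × ℂ) = r • ((z, w) : ℂ × ℂ) := rfl
        rw [mem_sphere_zero_iff_norm, this, norm_smul, hr, Complex.norm_real, norm_inv, norm_norm,
          inv_mul_cancel₀ (norm_ne_zero_iff.mpr hne)]
      exact ⟨⟨_, hmem⟩, by simp [num_scale, h1], by simp [den_scale, h2]⟩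
    · rintro ⟨⟨⟨z, w⟩, hzw⟩, h1, h2⟩ h
      refine (not_or.mpr ⟨not_not.mpr h1, not_not.mpr h2⟩) (h z w ?_)
      by_contra h0
      push Not at h0
      rw [h0.1, h0.2] at hzw
      simp at hzw
  rw [← isClosed_compl_iff, key]
  refine isClosedMap_snd_of_compactSpace _ ?_
  refine IsClosed.inter (isClosed_eq ?_ continuous_const) (isClosed_eq ?_ continuous_const)
  · unfold num; fun_prop
  · unfold den; fun_prop

/-- The space of rational maps of degree `n`, as an open subset of `CP (2n+1)`; as such it
inherits its topology and complex structure. -/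
def RationalMaps (n : ℕ) : TopologicalSpace.Opens (CP (2 * n + 1)) where
  carrier := condSet IsDegree isDegree_smul
  is_open' := isOpen_condSet ((isOpen_isDegree n).preimage continuous_subtype_val)

/-! ### Rational maps as maps of the 2-sphere -/

/-- Euclidean 3-space. -/
abbrev R3 : Type := EuclideanSpace ℝ (Fin 3)

/-- The unit sphere in Euclidean 3-space. -/
abbrev S2 : Type := sphere (0 : R3) 1

/-- Homogeneous stereographic coordinates `(z, w)` of a point of the sphere: for `p` other than
the north pole `z / w = (p₀ + i p₁) / (1 - p₂)` is the stereographic coordinate of `p`, and the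
north pole is `z / w = ∞`. -/
def stereo (p : S2) : ℂ × ℂ :=
  if p.1 2 = 1 then (1, 0) else (⟨p.1 0, p.1 1⟩, ((1 - p.1 2 : ℝ) : ℂ))

/-- The point of the sphere with stereographic coordinate `z / w`, as a vector in 3-space. -/
def invStereoVec (z w : ℂ) : R3 :=
  (‖z‖ ^ 2 + ‖w‖ ^ 2)⁻¹ •
    !₂[2 * (z * starRingEnd ℂ w).re, 2 * (z * starRingEnd ℂ w).im, ‖z‖ ^ 2 - ‖w‖ ^ 2]

theorem norm_invStereoVec {z w : ℂ} (h : z ≠ 0 ∨ w ≠ 0) : ‖invStereoVec z w‖ = 1 := by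
  have hpos : 0 < ‖z‖ ^ 2 + ‖w‖ ^ 2 := by
    rcases h with h | h
    · have := norm_pos_iff.mpr h
      positivity
    · have := norm_pos_iff.mpr h
      positivity
  have key : (2 * (z * starRingEnd ℂ w).re) ^ 2 + (2 * (z * starRingEnd ℂ w).im) ^ 2 +
      (‖z‖ ^ 2 - ‖w‖ ^ 2) ^ 2 = (‖z‖ ^ 2 + ‖w‖ ^ 2) ^ 2 := by
    simp only [Complex.sq_norm, Complex.normSq_apply, Complex.mul_re, Complex.mul_im,
      Complex.conj_re, Complex.conj_im]
    ring
  rw [invStereoVec, norm_smul, EuclideanSpace.norm_eq, Fin.sum_univ_three]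
  simp only [Real.norm_eq_abs, sq_abs, Matrix.cons_val_zero, Matrix.cons_val_one,
    Matrix.cons_val]
  rw [key, Real.sqrt_sq hpos.le, abs_of_pos (inv_pos.mpr hpos), inv_mul_cancel₀ hpos.ne']

theorem invStereoVec_smul {t : ℂ} (ht : t ≠ 0) (z w : ℂ) :
    invStereoVec (t * z) (t * w) = invStereoVec z w := by
  have h1 : t * z * starRingEnd ℂ (t * w) = ((‖t‖ ^ 2 : ℝ) : ℂ) * (z * starRingEnd ℂ w) := by
    rw [map_mul, Complex.ofReal_pow, ← Complex.mul_conj']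
    ring
  have hn : ‖t‖ ≠ 0 := norm_ne_zero_iff.mpr ht
  have h2 : ‖t‖ ^ 2 * ‖z‖ ^ 2 + ‖t‖ ^ 2 * ‖w‖ ^ 2 = ‖t‖ ^ 2 * (‖z‖ ^ 2 + ‖w‖ ^ 2) := by ring
  ext i
  simp only [invStereoVec, h1, Complex.re_ofReal_mul, Complex.im_ofReal_mul, norm_mul, mul_pow,
    h2, mul_inv, PiLp.smul_apply, smul_eq_mul]
  fin_cases i <;> simp <;> field_simp

theorem stereo_ne_zero (p : S2) : (stereo p).1 ≠ 0 ∨ (stereo p).2 ≠ 0 := by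
  unfold stereo
  split_ifs with h
  · exact Or.inl one_ne_zero
  · right
    exact Complex.ofReal_ne_zero.mpr (sub_ne_zero.mpr (Ne.symm h))

/-- The point of the sphere with stereographic coordinate `z / w`. -/
def invStereo (z w : ℂ) (h : z ≠ 0 ∨ w ≠ 0) : S2 :=
  ⟨invStereoVec z w, by simpa using norm_invStereoVec h⟩

theorem stereo_invStereo (z : ℂ) : ∃ c : ℂ, c ≠ 0 ∧
    (stereo (invStereo z 1 (by simp))).1 = c * z ∧
    (stereo (invStereo z 1 (by simp))).2 = c * 1 := by
  have hpos : 0 < ‖z‖ ^ 2 + 1 := by positivity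
  have h2 : (invStereo z 1 (by simp)).1 2 = (‖z‖ ^ 2 + 1)⁻¹ * (‖z‖ ^ 2 - 1) := by
    simp [invStereo, invStereoVec]
  have h0 : (invStereo z 1 (by simp)).1 0 = (‖z‖ ^ 2 + 1)⁻¹ * (2 * z.re) := by
    simp [invStereo, invStereoVec]
  have h1 : (invStereo z 1 (by simp)).1 1 = (‖z‖ ^ 2 + 1)⁻¹ * (2 * z.im) := by
    simp [invStereo, invStereoVec]
  have hne : (‖z‖ ^ 2 + 1)⁻¹ * (‖z‖ ^ 2 - 1) ≠ 1 := by
    intro h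
    rw [inv_mul_eq_one₀ hpos.ne'] at h
    linarith
  refine ⟨((2 * (‖z‖ ^ 2 + 1)⁻¹ : ℝ) : ℂ), ?_, ?_, ?_⟩
  · exact Complex.ofReal_ne_zero.mpr (by positivity)
  · rw [stereo, h2, if_neg hne, h0, h1]
    apply Complex.ext
    · rw [Complex.re_ofReal_mul]; ring
    · rw [Complex.im_ofReal_mul]; ring
  · rw [stereo, h2, if_neg hne, mul_one]
    refine congrArg Complex.ofReal ?_
    field_simp
    ring

theorem invStereoVec_cross {z w z' w' : ℂ} (h : z ≠ 0 ∨ w ≠ 0) (h' : z' ≠ 0 ∨ w' ≠ 0)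
    (he : invStereoVec z w = invStereoVec z' w') : z * w' = w * z' := by
  have hp : ∀ {z w : ℂ}, (z ≠ 0 ∨ w ≠ 0) → 0 < ‖z‖ ^ 2 + ‖w‖ ^ 2 := by
    rintro z w (h | h)
    · have := norm_pos_iff.mpr h
      positivity
    · have := norm_pos_iff.mpr h
      positivity
  have hN := hp h
  have hN' := hp h'
  have e0 := congrArg (fun v : R3 => v 0) he
  have e1 := congrArg (fun v : R3 => v 1) he
  have e2 := congrArg (fun v : R3 => v 2) he
  simp only [invStereoVec, PiLp.smul_apply, smul_eq_mul, Matrix.cons_val_zero,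
    Matrix.cons_val_one, Matrix.cons_val] at e0 e1 e2
  set N := ‖z‖ ^ 2 + ‖w‖ ^ 2 with hNdef
  set N' := ‖z'‖ ^ 2 + ‖w'‖ ^ 2 with hNdef'
  have hw : N' * ‖w‖ ^ 2 = N * ‖w'‖ ^ 2 := by
    field_simp at e2
    have q1 : ‖z‖ ^ 2 = N - ‖w‖ ^ 2 := by rw [hNdef]; ring
    have q2 : ‖z'‖ ^ 2 = N' - ‖w'‖ ^ 2 := by rw [hNdef']; ring
    rw [q1, q2] at e2
    linarith
  have hzw : (N' : ℂ) * (z * starRingEnd ℂ w) = N * (z' * starRingEnd ℂ w') := by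
    apply Complex.ext
    · rw [Complex.re_ofReal_mul, Complex.re_ofReal_mul]
      field_simp at e0
      linarith
    · rw [Complex.im_ofReal_mul, Complex.im_ofReal_mul]
      field_simp at e1
      linarith
  by_cases hw0 : w = 0
  · have : w' = 0 := by
      rw [hw0] at hw
      simpa [hN.ne'] using hw
    simp [hw0, this]
  · have hw1 : w' ≠ 0 := by
      rintro rfl
      simp [hN'.ne', hw0] at hw
    have hwc : (N' : ℂ) * (w * starRingEnd ℂ w) = N * (w' * starRingEnd ℂ w') := by
      rw [Complex.mul_conj', Complex.mul_conj']
      exact_mod_cast hw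
    have hc : starRingEnd ℂ w' ≠ 0 := by simpa using hw1
    have hc' : starRingEnd ℂ w ≠ 0 := by simpa using hw0
    have a1 : (N' : ℂ) ≠ 0 := Complex.ofReal_ne_zero.mpr hN'.ne'
    have a2 : (N : ℂ) ≠ 0 := Complex.ofReal_ne_zero.mpr hN.ne'
    apply mul_left_cancel₀ (mul_ne_zero (mul_ne_zero a1 hc') (mul_ne_zero a2 hc))
    linear_combination (N * w' * starRingEnd ℂ w') * hzw - (N * z' * starRingEnd ℂ w') * hwc

/-- The self-map of the sphere defined by a point of `RationalMaps n`: in stereographic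
coordinates on domain and codomain it is the quotient of numerator and denominator. -/
def toMap {n : ℕ} (φ : RationalMaps n) (p : S2) : S2 :=
  ⟨Projectivization.lift
    (fun a : {a : Fin (2 * n + 1 + 1) → ℂ // a ≠ 0} =>
      invStereoVec (num a.1 (stereo p).1 (stereo p).2) (den a.1 (stereo p).1 (stereo p).2)) (by
      rintro ⟨a, ha⟩ ⟨b, hb⟩ t (rfl : a = t • b)
      have ht : t ≠ 0 := by rintro rfl; simp at ha
      simp only [num_smul, den_smul]
      exact invStereoVec_smul ht _ _) φ.1, by
    obtain ⟨x, hx⟩ := φ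
    induction x using Projectivization.ind with
    | h a ha =>
      have hx' : IsDegree a := hx
      simpa using norm_invStereoVec ((isDegree_iff a).mp hx' _ _ (stereo_ne_zero p))⟩

/-- In the affine stereographic coordinate `z`, the map with coefficients `a` is
`z ↦ (a₀ + ⋯ + aₙ zⁿ) / (aₙ₊₁ + ⋯ + a₂ₙ₊₁ zⁿ)` wherever the denominator does not vanish. -/
theorem toMap_invStereo {n : ℕ} (a : Fin (2 * n + 1 + 1) → ℂ) (ha : a ≠ 0) (h : IsDegree a)
    (z : ℂ) (hz : den a z 1 ≠ 0) :
    toMap (⟨Projectivization.mk ℂ a ha, h⟩ : RationalMaps n) (invStereo z 1 (by simp)) =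
      invStereo (num a z 1 / den a z 1) 1 (by simp) := by
  obtain ⟨c, hc, h1, h2⟩ := stereo_invStereo z
  apply Subtype.ext
  change invStereoVec (num a (stereo (invStereo z 1 (by simp))).1
    (stereo (invStereo z 1 (by simp))).2) (den a (stereo (invStereo z 1 (by simp))).1
    (stereo (invStereo z 1 (by simp))).2) = invStereoVec (num a z 1 / den a z 1) 1
  rw [h1, h2, num_scale, den_scale, invStereoVec_smul (pow_ne_zero n hc),
    ← invStereoVec_smul hz (num a z 1 / den a z 1) 1, mul_div_cancel₀ _ hz, mul_one]

/-- The numerator as a polynomial. -/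
def numPoly {n : ℕ} (a : Fin (2 * n + 1 + 1) → ℂ) : Polynomial ℂ :=
  ∑ k : Fin (n + 1), Polynomial.monomial (k : ℕ) (a ⟨k, by omega⟩)

/-- The denominator as a polynomial. -/
def denPoly {n : ℕ} (a : Fin (2 * n + 1 + 1) → ℂ) : Polynomial ℂ :=
  ∑ k : Fin (n + 1), Polynomial.monomial (k : ℕ) (a ⟨n + 1 + k, by omega⟩)

@[simp]
theorem eval_numPoly {n : ℕ} (a : Fin (2 * n + 1 + 1) → ℂ) (z : ℂ) :
    (numPoly a).eval z = num a z 1 := by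
  simp [numPoly, num, Polynomial.eval_finsetSum, Polynomial.eval_monomial]

@[simp]
theorem eval_denPoly {n : ℕ} (a : Fin (2 * n + 1 + 1) → ℂ) (z : ℂ) :
    (denPoly a).eval z = den a z 1 := by
  simp [denPoly, den, Polynomial.eval_finsetSum, Polynomial.eval_monomial]

theorem coeff_numPoly {n : ℕ} (a : Fin (2 * n + 1 + 1) → ℂ) (k : Fin (n + 1)) :
    (numPoly a).coeff k = a ⟨k, by omega⟩ := by
  simp [numPoly, Polynomial.coeff_monomial, ← Fin.ext_iff]

theorem coeff_denPoly {n : ℕ} (a : Fin (2 * n + 1 + 1) → ℂ) (k : Fin (n + 1)) :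
    (denPoly a).coeff k = a ⟨n + 1 + k, by omega⟩ := by
  simp [denPoly, Polynomial.coeff_monomial, ← Fin.ext_iff]

theorem isCoprime_poly {n : ℕ} {a : Fin (2 * n + 1 + 1) → ℂ} (h : IsDegree a) :
    IsCoprime (numPoly a) (denPoly a) := by
  rw [Polynomial.isCoprime_iff_aeval_ne_zero_of_isAlgClosed ℂ ℂ]
  intro z
  have := h.2 z
  simp only [Polynomial.coe_aeval_eq_eval, eval_numPoly, eval_denPoly]
  tauto

/-- Points of `RationalMaps n` are determined by the maps of the sphere that they define. -/
theorem toMap_injective (n : ℕ) :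
    Function.Injective (toMap : RationalMaps n → S2 → S2) := by
  rintro ⟨x, hx⟩ ⟨y, hy⟩ h
  induction x using Projectivization.ind with
  | h a ha =>
  induction y using Projectivization.ind with
  | h b hb =>
  have hda : IsDegree a := hx
  have hdb : IsDegree b := hy
  have hcross : ∀ z : ℂ, num a z 1 * den b z 1 = den a z 1 * num b z 1 := by
    intro z
    obtain ⟨c, hc, h1, h2⟩ := stereo_invStereo z
    have e := congrArg Subtype.val (congrFun h (invStereo z 1 (by simp)))
    change invStereoVec (num a (stereo (invStereo z 1 (by simp))).1
      (stereo (invStereo z 1 (by simp))).2) (den a (stereo (invStereo z 1 (by simp))).1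
      (stereo (invStereo z 1 (by simp))).2) =
      invStereoVec (num b (stereo (invStereo z 1 (by simp))).1
      (stereo (invStereo z 1 (by simp))).2) (den b (stereo (invStereo z 1 (by simp))).1
      (stereo (invStereo z 1 (by simp))).2) at e
    rw [h1, h2, num_scale, den_scale, num_scale, den_scale, invStereoVec_smul (pow_ne_zero n hc),
      invStereoVec_smul (pow_ne_zero n hc)] at e
    exact invStereoVec_cross ((isDegree_iff a).mp hda z 1 (by simp))
      ((isDegree_iff b).mp hdb z 1 (by simp)) e
  have hpoly : numPoly a * denPoly b = denPoly a * numPoly b :=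
    Polynomial.funext fun z => by simpa using hcross z
  obtain ⟨u, v, huv⟩ := isCoprime_poly hda
  obtain ⟨u', v', huv'⟩ := isCoprime_poly hdb
  set C := u * numPoly b + v * denPoly b with hC
  set D := u' * numPoly a + v' * denPoly a with hD
  have e1 : numPoly b = C * numPoly a := by
    rw [hC]; linear_combination (-numPoly b) * huv - v * hpoly
  have e2 : denPoly b = C * denPoly a := by
    rw [hC]; linear_combination (-denPoly b) * huv + u * hpoly
  have e3 : numPoly a = D * numPoly b := by
    rw [hD]; linear_combination (-numPoly a) * huv' + v' * hpoly
  have e4 : denPoly a = D * denPoly b := by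
    rw [hD]; linear_combination (-denPoly a) * huv' - u' * hpoly
  have hCD : C * D = 1 := by
    have f1 : numPoly a = D * C * numPoly a := by rw [mul_assoc, ← e1, ← e3]
    have f2 : denPoly a = D * C * denPoly a := by rw [mul_assoc, ← e2, ← e4]
    linear_combination (1 - C * D) * huv - u * f1 - v * f2
  obtain ⟨t, ht, htC⟩ := Polynomial.isUnit_iff.mp (IsUnit.of_mul_eq_one D hCD)
  apply Subtype.ext
  refine ((Projectivization.mk_eq_mk_iff' ℂ b a hb ha).mpr ⟨t, ?_⟩).symm
  funext j
  rw [← htC] at e1 e2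
  rcases lt_or_ge j.1 (n + 1) with hj | hj
  · have := congrArg (fun p => Polynomial.coeff p j.1) e1
    simp only [Polynomial.coeff_C_mul] at this
    have g1 := coeff_numPoly a ⟨j.1, hj⟩
    have g2 := coeff_numPoly b ⟨j.1, hj⟩
    simp only [Fin.eta] at g1 g2
    rw [g1, g2] at this
    exact this.symm
  · have hj2 := j.2
    have := congrArg (fun p => Polynomial.coeff p (j.1 - (n + 1))) e2
    simp only [Polynomial.coeff_C_mul] at this
    have g1 := coeff_denPoly a ⟨j.1 - (n + 1), by omega⟩
    have g2 := coeff_denPoly b ⟨j.1 - (n + 1), by omega⟩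
    have hjj : (⟨n + 1 + (j.1 - (n + 1)), by omega⟩ : Fin (2 * n + 1 + 1)) = j :=
      Fin.ext (by simp; omega)
    simp only [hjj] at g1 g2
    rw [g1, g2] at this
    exact this.symm

/-! ### The `L²` metric -/

/-- The area measure of the round unit sphere. -/
def area : Measure S2 := (volume : Measure R3).toSphere

/-- A tangent vector `X` at `φ` as a section of the pullback of the tangent bundle of the sphere:
at `p` its value is the derivative of the evaluation map `ψ ↦ ψ(p)` at `φ` in the direction `X`,
which is a vector in 3-space tangent to the sphere at `φ(p)`. -/
def variation {n : ℕ} (φ : RationalMaps n)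
    (X : TangentSpace 𝓘(ℝ, Fin (2 * n + 1) → ℂ) φ) (p : S2) : R3 :=
  mfderiv 𝓘(ℝ, Fin (2 * n + 1) → ℂ) 𝓘(ℝ, R3) (fun ψ : RationalMaps n => (toMap ψ p : R3)) φ X

/-- The `L²` inner product of tangent vectors at `φ`; the round metric on the codomain is the one
induced from 3-space. -/
def l2Inner {n : ℕ} (φ : RationalMaps n)
    (X Y : TangentSpace 𝓘(ℝ, Fin (2 * n + 1) → ℂ) φ) : ℝ :=
  ∫ p, inner ℝ (variation φ X p) (variation φ Y p) ∂area

end RatMap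

end

open RatMap

/-!
In an affine chart of projective space with coordinates `y`, the value of the rational map at the
point of the sphere with homogeneous coordinates `s = (z, w)` is the image under the Hopf map
`(u, v) ↦ invStereoVec u v` of numerator and denominator `u`, `v`, which are affine in `y`. The
point `s` may be taken in the unit sphere of `ℂ²`, which is compact, and then everything is smooth
in `(s, y)`; hence the `L²` metric is an integral of smooth functions of `y` over a compact space
of parameters, and may be differentiated under the integral sign
(`contDiffOn_integral_comp`, `fderiv_integral_comp_apply`).

For tangent vectors `X`, `Y` put `η(X) = v du(X) - u dv(X)` and `N = |u|² + |v|²`. The pullback of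
the round metric is `4 Re (η(X) conj η(Y)) / N²` (`inner_hopfDeriv`, `pullMetric_eq`), which is
Hermitian as `η` is complex linear. If it vanishes at `X = Y` for all `s`, then `v du(X) = u dv(X)`
as polynomials; since `u`, `v` are coprime of degree `n`, `(du(X), dv(X))` is a constant multiple of
`(u, v)`, and the normalisation of one coefficient to `1` in the chart forces `X = 0`
(`exists_wronskAt_ne_zero`). This gives positivity (`metricAt_self_pos`).

The pulled back area form `(X, Y) ↦ 4 Re (i η(X) conj η(Y)) / N²` is the exterior derivative of
`2 Im (ū du + v̄ dv) / N` (`potFormDeriv_sub`). Integrating over the sphere, the fundamental form of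
the `L²` metric is exact in each chart, hence closed (`exists_closed_form`).

These coordinate statements pass to the manifold because every chart of the space of rational maps
is a restriction of an affine chart (`exists_chart_index`), with holomorphic inverse
(`J_mfderiv_symm`).
-/

/-! ### Smooth integrals over a compact space of parameters -/

section Parameters

variable {α P F : Type*} [MeasurableSpace α] {μ : Measure α} [NormedAddCommGroup P]
  [MeasurableSpace P] [BorelSpace P] [NormedAddCommGroup F] {K : Set P} {s : α → P} {g : P → F}

theorem aestronglyMeasurable_comp_of_continuousOn (hK : IsCompact K)
    (hs : Measurable s) (hsK : ∀ a, s a ∈ K) (hg : ContinuousOn g K) :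
    AEStronglyMeasurable (fun a => g (s a)) μ := by
  have : CompactSpace K := isCompact_iff_compactSpace.mp hK
  have h1 : StronglyMeasurable (K.domRestrict g) :=
    (continuousOn_iff_continuous_domRestrict.mp hg).stronglyMeasurable
  exact (h1.comp_measurable (hs.subtype_mk (h := hsK))).aestronglyMeasurable

theorem integrable_comp_of_continuousOn [IsFiniteMeasure μ] (hK : IsCompact K)
    (hs : Measurable s) (hsK : ∀ a, s a ∈ K) (hg : ContinuousOn g K) :
    Integrable (fun a => g (s a)) μ := by
  obtain ⟨C, hC⟩ := hK.exists_bound_of_continuousOn hg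
  exact .of_bound (aestronglyMeasurable_comp_of_continuousOn hK hs hsK hg) C
    (.of_forall fun a => hC _ (hsK a))

theorem integrable_comp_prodMk {E : Type*} [TopologicalSpace E] [IsFiniteMeasure μ]
    {W : Set (P × E)} {h : P × E → F} (hK : IsCompact K) (hs : Measurable s)
    (hsK : ∀ a, s a ∈ K) (hh : ContinuousOn h W) {y : E} (hKW : ∀ x ∈ K, (x, y) ∈ W) :
    Integrable (fun a => h (s a, y)) μ :=
  integrable_comp_of_continuousOn (g := fun x => h (x, y)) hK hs hsK
    (hh.comp (by fun_prop) hKW)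

end Parameters

section FDerivSnd

variable {P E F : Type*} [NormedAddCommGroup P] [NormedSpace ℝ P]
  [NormedAddCommGroup E] [NormedSpace ℝ E] [NormedAddCommGroup F] [NormedSpace ℝ F]
  {W : Set (P × E)} {h : P × E → F}

/-- The derivative in the second variable. -/
noncomputable def fderivSnd (h : P × E → F) (q : P × E) : E →L[ℝ] F :=
  (fderiv ℝ h q).comp (ContinuousLinearMap.inr ℝ P E)

theorem ContDiffOn.fderivSnd (hW : IsOpen W) (hh : ContDiffOn ℝ ∞ h W) :
    ContDiffOn ℝ ∞ (fderivSnd h) W :=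
  (hh.fderiv_of_isOpen hW (by simp)).clm_comp contDiffOn_const

theorem hasFDerivAt_fderivSnd (hW : IsOpen W) (hh : ContDiffOn ℝ ∞ h W) {x : P} {y : E}
    (hxy : (x, y) ∈ W) : HasFDerivAt (fun y => h (x, y)) (fderivSnd h (x, y)) y :=
  (((hh.contDiffAt (hW.mem_nhds hxy)).differentiableAt (by simp)).hasFDerivAt).comp y
    (hasFDerivAt_prodMk_right x y)

/-- A derivative along a line is a value of the derivative in the second variable. -/
theorem fderivSnd_apply_of_hasDerivAt (hW : IsOpen W) (hh : ContDiffOn ℝ ∞ h W) {x : P} {y : E}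
    (hxy : (x, y) ∈ W) {v : E} {f' : F}
    (hf : HasDerivAt (fun t : ℝ => h (x, y + t • v)) f' 0) : fderivSnd h (x, y) v = f' := by
  have h1 : HasDerivAt (fun t : ℝ => y + t • v) v 0 := by
    simpa using ((hasDerivAt_id (0 : ℝ)).smul_const v).const_add y
  have h3 : HasFDerivAt (fun y => h (x, y)) (fderivSnd h (x, y)) (y + (0 : ℝ) • v) := by
    simpa using hasFDerivAt_fderivSnd hW hh hxy
  have h4 : HasDerivAt (fun t : ℝ => h (x, y + t • v)) (fderivSnd h (x, y) v) 0 :=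
    HasFDerivAt.comp_hasDerivAt (l := fun y => h (x, y)) 0 h3 h1
  exact h4.unique hf

end FDerivSnd

section ParametricIntegral

variable {α P E : Type*} [MeasurableSpace α] {μ : Measure α} [IsFiniteMeasure μ]
  [NormedAddCommGroup P] [NormedSpace ℝ P] [MeasurableSpace P] [BorelSpace P]
  [NormedAddCommGroup E] [NormedSpace ℝ E]
  {K : Set P} {s : α → P} {W : Set (P × E)}

/-- Differentiation under the integral sign. The domination comes from the compactness of the
parameter set `K`, via the tube lemma. -/
theorem hasFDerivAt_integral_comp {F : Type*} [NormedAddCommGroup F] [NormedSpace ℝ F]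
    {h : P × E → F} (hK : IsCompact K)
    (hs : Measurable s) (hsK : ∀ a, s a ∈ K) (hW : IsOpen W) (hh : ContDiffOn ℝ ∞ h W) {y : E}
    (hKW : ∀ x ∈ K, (x, y) ∈ W) :
    HasFDerivAt (fun y => ∫ a, h (s a, y) ∂μ) (∫ a, fderivSnd h (s a, y) ∂μ) y := by
  have hD := (hh.fderivSnd hW).continuousOn
  obtain ⟨C, hC⟩ := hK.exists_bound_of_continuousOn (f := fun x => fderivSnd h (x, y))
    (hD.comp (by fun_prop) hKW)
  have hopen : IsOpen {q ∈ W | ‖fderivSnd h q‖ < C + 1} :=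
    hD.norm.isOpen_inter_preimage hW isOpen_Iio
  obtain ⟨u, v, -, hv, hKu, hyv, huv⟩ := generalized_tube_lemma hK (isCompact_singleton (x := y))
    hopen (by
      rintro ⟨x, y'⟩ ⟨hx, rfl⟩
      exact ⟨hKW x hx, (hC x hx).trans_lt (lt_add_one C)⟩)
  have hvy : v ∈ nhds y := hv.mem_nhds (hyv rfl)
  have hmem : ∀ a, ∀ y' ∈ v, (s a, y') ∈ W ∧ ‖fderivSnd h (s a, y')‖ < C + 1 :=
    fun a y' hy' => huv ⟨hKu (hsK a), hy'⟩
  refine (hasFDerivAt_integral_of_dominated_of_fderiv_le (bound := fun _ => C + 1)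
    (F' := fun y a => fderivSnd h (s a, y)) hvy
    ?_ (integrable_comp_prodMk hK hs hsK hh.continuousOn hKW)
    (integrable_comp_prodMk hK hs hsK hD hKW).aestronglyMeasurable ?_
    (integrable_const _) ?_)
  · filter_upwards [hvy] with y' hy'
    refine aestronglyMeasurable_comp_of_continuousOn (g := fun x => h (x, y')) hK hs hsK ?_
    exact hh.continuousOn.comp (by fun_prop) fun x hx => (huv ⟨hKu hx, hy'⟩).1
  · exact .of_forall fun a y' hy' => (hmem a y' hy').2.le
  · exact .of_forall fun a y' hy' => hasFDerivAt_fderivSnd hW hh (hmem a y' hy').1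

theorem contDiffOn_nat_integral_comp [FiniteDimensional ℝ E] {U : Set E} (hK : IsCompact K)
    (hs : Measurable s) (hsK : ∀ a, s a ∈ K) (hW : IsOpen W) (hU : IsOpen U)
    (hKW : ∀ x ∈ K, ∀ y ∈ U, (x, y) ∈ W)
    (m : ℕ) {h : P × E → ℝ} (hh : ContDiffOn ℝ ∞ h W) :
    ContDiffOn ℝ m (fun y => ∫ a, h (s a, y) ∂μ) U := by
  have hder : ∀ {h : P × E → ℝ} (_ : ContDiffOn ℝ ∞ h W), ∀ y ∈ U,
      HasFDerivAt (fun y => ∫ a, h (s a, y) ∂μ) (∫ a, fderivSnd h (s a, y) ∂μ) y :=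
    fun hh y hy => hasFDerivAt_integral_comp hK hs hsK hW hh fun x hx => hKW x hx y hy
  induction m generalizing h with
  | zero =>
    rw [Nat.cast_zero, contDiffOn_zero]
    exact fun y hy => (hder hh y hy).continuousAt.continuousWithinAt
  | succ m ih =>
    push_cast
    rw [contDiffOn_succ_iff_fderiv_of_isOpen hU]
    refine ⟨fun y hy => (hder hh y hy).differentiableAt.differentiableWithinAt, by simp, ?_⟩
    rw [contDiffOn_clm_apply]
    intro v
    refine (ih (h := fun q => fderivSnd h q v)
      ((hh.fderivSnd hW).clm_apply contDiffOn_const)).congr fun y hy => ?_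
    rw [(hder hh y hy).fderiv, ContinuousLinearMap.integral_apply]
    exact integrable_comp_prodMk hK hs hsK (hh.fderivSnd hW).continuousOn
      fun x hx => hKW x hx y hy

/-- An integral depending smoothly on a parameter is smooth. -/
theorem contDiffOn_integral_comp [FiniteDimensional ℝ E] {U : Set E} (hK : IsCompact K)
    (hs : Measurable s) (hsK : ∀ a, s a ∈ K) (hW : IsOpen W) (hU : IsOpen U)
    (hKW : ∀ x ∈ K, ∀ y ∈ U, (x, y) ∈ W)
    {h : P × E → ℝ} (hh : ContDiffOn ℝ ∞ h W) :
    ContDiffOn ℝ ∞ (fun y => ∫ a, h (s a, y) ∂μ) U :=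
  contDiffOn_infty.mpr fun m => contDiffOn_nat_integral_comp hK hs hsK hW hU hKW m hh

theorem fderiv_integral_comp_apply (hK : IsCompact K) (hs : Measurable s)
    (hsK : ∀ a, s a ∈ K) (hW : IsOpen W) {h : P × E → ℝ} (hh : ContDiffOn ℝ ∞ h W) {y : E}
    (hKW : ∀ x ∈ K, (x, y) ∈ W) (v : E) :
    fderiv ℝ (fun y => ∫ a, h (s a, y) ∂μ) y v = ∫ a, fderivSnd h (s a, y) v ∂μ := by
  rw [(hasFDerivAt_integral_comp hK hs hsK hW hh hKW).fderiv, ContinuousLinearMap.integral_apply]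
  exact integrable_comp_prodMk hK hs hsK (hh.fderivSnd hW).continuousOn hKW

end ParametricIntegral

namespace RatMap

/-! ### The Fubini–Study form along lines in `ℂ²` -/

theorem normSq_add_normSq_pos {u v : ℂ} (h : u ≠ 0 ∨ v ≠ 0) : 0 < normSq u + normSq v := by
  rcases h with h | h
  · have := normSq_pos.mpr h
    have := normSq_nonneg v
    positivity
  · have := normSq_pos.mpr h
    have := normSq_nonneg u
    positivity

/-- The Wronskian-type expression `v u' - u v'`; the differential of `u / v` is its quotient by
`v ^ 2`. -/
noncomputable def wronsk (u v u' v' : ℂ) : ℂ := v * u' - u * v'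

/-- The derivative of the Hopf map `invStereoVec` at `(u, v)` in the direction `(u', v')`. -/
noncomputable def hopfDeriv (u v u' v' : ℂ) : R3 :=
  ((normSq u + normSq v) ^ 2)⁻¹ •
    !₂[2 * ((starRingEnd ℂ v) ^ 2 * wronsk u v u' v' -
          u ^ 2 * starRingEnd ℂ (wronsk u v u' v')).re,
      2 * ((starRingEnd ℂ v) ^ 2 * wronsk u v u' v' -
          u ^ 2 * starRingEnd ℂ (wronsk u v u' v')).im,
      4 * (starRingEnd ℂ u * starRingEnd ℂ v * wronsk u v u' v').re]

theorem hasDerivAt_affine (a b : ℝ) : HasDerivAt (fun t : ℝ => a + t * b) b 0 := by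
  simpa using ((hasDerivAt_id (0 : ℝ)).mul_const b).const_add a

theorem hasDerivAt_normSq_line (u u' : ℂ) :
    HasDerivAt (fun t : ℝ => normSq (u + t * u')) (2 * (u.re * u'.re + u.im * u'.im)) 0 := by
  have h := (((hasDerivAt_affine u.re u'.re).fun_mul (hasDerivAt_affine u.re u'.re)).fun_add
    ((hasDerivAt_affine u.im u'.im).fun_mul (hasDerivAt_affine u.im u'.im)))
  have e : (fun t : ℝ => normSq (u + t * u')) = fun t : ℝ =>
      (u.re + t * u'.re) * (u.re + t * u'.re) + (u.im + t * u'.im) * (u.im + t * u'.im) := by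
    funext t
    simp [normSq_apply]
  rw [e]
  exact h.congr_deriv (by simp; ring)

theorem hasDerivAt_mul_conj_line (u v u' v' : ℂ) :
    HasDerivAt (fun t : ℝ => (u + t * u') * starRingEnd ℂ (v + t * v'))
      (u' * starRingEnd ℂ v + u * starRingEnd ℂ v') 0 := by
  have h1 : ∀ a b : ℂ, HasDerivAt (fun t : ℝ => a + t * b) b 0 := fun a b => by
    simpa using (((hasDerivAt_id (0 : ℝ)).ofReal_comp).mul_const b).const_add a
  have e : (fun t : ℝ => (u + t * u') * starRingEnd ℂ (v + t * v')) =
      fun t : ℝ => (u + t * u') * (starRingEnd ℂ v + t * starRingEnd ℂ v') := by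
    funext t
    simp
  rw [e]
  exact ((h1 u u').fun_mul (h1 (starRingEnd ℂ v) (starRingEnd ℂ v'))).congr_deriv (by simp)

theorem hasDerivAt_invStereoVec_line {u v : ℂ} (h : u ≠ 0 ∨ v ≠ 0) (u' v' : ℂ) :
    HasDerivAt (fun t : ℝ => invStereoVec (u + t * u') (v + t * v')) (hopfDeriv u v u' v') 0 := by
  have hN := (normSq_add_normSq_pos h).ne'
  have hNd := ((hasDerivAt_normSq_line u u').fun_add (hasDerivAt_normSq_line v v')).fun_inv
      (by simpa using hN)
  have hzw := hasDerivAt_mul_conj_line u v u' v'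
  have hre := (reCLM.hasFDerivAt.comp_hasDerivAt 0 hzw).const_mul 2
  have him := (imCLM.hasFDerivAt.comp_hasDerivAt 0 hzw).const_mul 2
  have hd := (hasDerivAt_normSq_line u u').fun_sub (hasDerivAt_normSq_line v v')
  simp only [normSq_apply] at hN
  have key : ∀ i, HasDerivAt (fun t : ℝ => invStereoVec (u + t * u') (v + t * v') i)
      (hopfDeriv u v u' v' i) 0 := by
    refine Fin.forall_fin_succ.mpr ⟨?_, Fin.forall_fin_two.mpr ⟨?_, ?_⟩⟩
    · refine ((hNd.fun_mul hre).congr_deriv ?_).congr_of_eventuallyEq (.of_forall fun t => ?_)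
      · simp [hopfDeriv, wronsk, normSq_apply]
        field_simp
        simp [pow_two]
        ring
      · simp [invStereoVec, ← normSq_eq_norm_sq]
    · refine ((hNd.fun_mul him).congr_deriv ?_).congr_of_eventuallyEq (.of_forall fun t => ?_)
      · simp [hopfDeriv, wronsk, normSq_apply]
        field_simp
        simp [pow_two]
        ring
      · simp [invStereoVec, ← normSq_eq_norm_sq]
    · refine ((hNd.fun_mul hd).congr_deriv ?_).congr_of_eventuallyEq (.of_forall fun t => ?_)
      · simp [hopfDeriv, wronsk, normSq_apply]
        field_simp
        ring
      · simp [invStereoVec, ← normSq_eq_norm_sq]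
  rw [hasDerivAt_iff_hasFDerivAt, ← hasFDerivWithinAt_univ, hasFDerivWithinAt_euclidean]
  refine fun i => ((key i).hasFDerivAt.congr_fderiv ?_).hasFDerivWithinAt
  ext
  simp

/-- The round metric is the Fubini–Study metric: the Hopf map is a Riemannian submersion, up to
the factor `4`. -/
theorem inner_hopfDeriv {u v : ℂ} (h : u ≠ 0 ∨ v ≠ 0) (u' v' u'' v'' : ℂ) :
    inner ℝ (hopfDeriv u v u' v') (hopfDeriv u v u'' v'') =
      4 * (wronsk u v u' v' * starRingEnd ℂ (wronsk u v u'' v'')).re /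
        (normSq u + normSq v) ^ 2 := by
  have hN := (normSq_add_normSq_pos h).ne'
  simp only [hopfDeriv, inner_smul_left, inner_smul_right]
  generalize wronsk u v u' v' = a
  generalize wronsk u v u'' v'' = b
  have key : inner ℝ (!₂[2 * ((starRingEnd ℂ v) ^ 2 * a - u ^ 2 * starRingEnd ℂ a).re,
      2 * ((starRingEnd ℂ v) ^ 2 * a - u ^ 2 * starRingEnd ℂ a).im,
      4 * (starRingEnd ℂ u * starRingEnd ℂ v * a).re] : R3)
      !₂[2 * ((starRingEnd ℂ v) ^ 2 * b - u ^ 2 * starRingEnd ℂ b).re,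
      2 * ((starRingEnd ℂ v) ^ 2 * b - u ^ 2 * starRingEnd ℂ b).im,
      4 * (starRingEnd ℂ u * starRingEnd ℂ v * b).re] =
      4 * (a * starRingEnd ℂ b).re * (normSq u + normSq v) ^ 2 := by
    simp only [PiLp.inner_apply, Fin.sum_univ_three, normSq_apply]
    simp [pow_two]
    ring
  rw [key]
  simp only [conj_trivial]
  field_simp

/-- The value `Im (ū u' + v̄ v') / (|u|² + |v|²)` at `(u', v')` of a primitive of half the
Fubini–Study form; it is half of `dᶜ log (|u|² + |v|²)`, up to sign. -/
noncomputable def potForm (u v u' v' : ℂ) : ℝ :=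
  (starRingEnd ℂ u * u' + starRingEnd ℂ v * v').im / (normSq u + normSq v)

/-- The derivative of `potForm` in the base point `(u, v)` along `(u', v')`, at the fixed tangent
vector `(u'', v'')`. -/
noncomputable def potFormDeriv (u v u' v' u'' v'' : ℂ) : ℝ :=
  ((starRingEnd ℂ u' * u'' + starRingEnd ℂ v' * v'').im * (normSq u + normSq v) -
    (starRingEnd ℂ u * u'' + starRingEnd ℂ v * v'').im *
    (2 * (u.re * u'.re + u.im * u'.im) + 2 * (v.re * v'.re + v.im * v'.im))) /
    (normSq u + normSq v) ^ 2

theorem hasDerivAt_potForm_line {u v : ℂ} (h : u ≠ 0 ∨ v ≠ 0) (u' v' u'' v'' : ℂ) :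
    HasDerivAt (fun t : ℝ => potForm (u + t * u') (v + t * v') u'' v'')
      (potFormDeriv u v u' v' u'' v'') 0 := by
  have hN := (normSq_add_normSq_pos h).ne'
  have h1 : HasDerivAt (fun t : ℝ => (starRingEnd ℂ (u + t * u') * u'' +
      starRingEnd ℂ (v + t * v') * v'').im)
      (starRingEnd ℂ u' * u'' + starRingEnd ℂ v' * v'').im 0 := by
    have e : (fun t : ℝ => (starRingEnd ℂ (u + t * u') * u'' +
        starRingEnd ℂ (v + t * v') * v'').im) =
        fun t : ℝ => (starRingEnd ℂ u * u'' + starRingEnd ℂ v * v'').im +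
          t * (starRingEnd ℂ u' * u'' + starRingEnd ℂ v' * v'').im := by
      funext t
      simp
      ring
    rw [e]
    exact hasDerivAt_affine _ _
  have := h1.fun_div ((hasDerivAt_normSq_line u u').fun_add (hasDerivAt_normSq_line v v'))
    (by simpa using hN)
  simpa [potForm, potFormDeriv] using this

/-- The exterior derivative of `2 * potForm` is the fundamental form of the round metric. -/
theorem potFormDeriv_sub {u v : ℂ} (h : u ≠ 0 ∨ v ≠ 0) (u' v' u'' v'' : ℂ) :
    2 * (potFormDeriv u v u' v' u'' v'' - potFormDeriv u v u'' v'' u' v') =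
      4 * (wronsk u v (I * u') (I * v') * starRingEnd ℂ (wronsk u v u'' v'')).re /
        (normSq u + normSq v) ^ 2 := by
  have hN := (normSq_add_normSq_pos h).ne'
  simp only [potFormDeriv, wronsk]
  simp only [normSq_apply] at hN ⊢
  field_simp
  simp
  ring

/-! ### Rational maps in affine coordinates -/

/-- The vector with `i`-th entry `0` and the other entries `X`; this is the linear part of the
affine map `insertOne i`. -/
noncomputable def insertZero {N : ℕ} (i : Fin (N + 1)) (X : Fin N → ℂ) : Fin (N + 1) → ℂ :=
  Fin.insertNth (α := fun _ => ℂ) i 0 X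

theorem insertOne_add {N : ℕ} (i : Fin (N + 1)) (y X : Fin N → ℂ) (t : ℂ) :
    (insertOne i (y + t • X)).1 = (insertOne i y).1 + t • insertZero i X := by
  funext j
  rcases Fin.eq_self_or_eq_succAbove i j with rfl | ⟨k, rfl⟩ <;> simp [insertOne, insertZero]

theorem insertZero_smul {N : ℕ} (i : Fin (N + 1)) (X : Fin N → ℂ) (t : ℂ) :
    insertZero i (t • X) = t • insertZero i X := by
  funext j
  rcases Fin.eq_self_or_eq_succAbove i j with rfl | ⟨k, rfl⟩ <;> simp [insertZero]

theorem insertZero_add {N : ℕ} (i : Fin (N + 1)) (X Y : Fin N → ℂ) :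
    insertZero i (X + Y) = insertZero i X + insertZero i Y := by
  funext j
  rcases Fin.eq_self_or_eq_succAbove i j with rfl | ⟨k, rfl⟩ <;> simp [insertZero]

theorem insertZero_ne_zero {N : ℕ} {i : Fin (N + 1)} {X : Fin N → ℂ} (h : X ≠ 0) :
    insertZero i X ≠ 0 := by
  contrapose! h
  funext k
  simpa [insertZero] using congrFun h (i.succAbove k)

theorem contDiff_insertOne {N : ℕ} (i j : Fin (N + 1)) :
    ContDiff ℝ ∞ (fun y : Fin N → ℂ => (insertOne i y).1 j) := by
  rcases Fin.eq_self_or_eq_succAbove i j with rfl | ⟨l, rfl⟩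
  · simpa [insertOne] using contDiff_const
  · simpa [insertOne] using contDiff_apply ℝ ℂ l

section

variable {n : ℕ}

theorem num_add (a b : Fin (2 * n + 1 + 1) → ℂ) (z w : ℂ) :
    num (a + b) z w = num a z w + num b z w := by
  simp [num, add_mul, Finset.sum_add_distrib]

theorem den_add (a b : Fin (2 * n + 1 + 1) → ℂ) (z w : ℂ) :
    den (a + b) z w = den a z w + den b z w := by
  simp [den, add_mul, Finset.sum_add_distrib]

variable (i : Fin (2 * n + 1 + 1))

/-- The numerator at `q.1` of the map with affine coordinates `q.2` in the `i`-th chart. -/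
noncomputable def numAt (q : (ℂ × ℂ) × (Fin (2 * n + 1) → ℂ)) : ℂ :=
  num (insertOne i q.2).1 q.1.1 q.1.2

/-- The denominator at `q.1` of the map with affine coordinates `q.2` in the `i`-th chart. -/
noncomputable def denAt (q : (ℂ × ℂ) × (Fin (2 * n + 1) → ℂ)) : ℂ :=
  den (insertOne i q.2).1 q.1.1 q.1.2

/-- The differential of `numAt i` in the coefficients. -/
noncomputable def dnum (X : Fin (2 * n + 1) → ℂ) (s : ℂ × ℂ) : ℂ := num (insertZero i X) s.1 s.2

/-- The differential of `denAt i` in the coefficients. -/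
noncomputable def dden (X : Fin (2 * n + 1) → ℂ) (s : ℂ × ℂ) : ℂ := den (insertZero i X) s.1 s.2

theorem numAt_add (s : ℂ × ℂ) (y X : Fin (2 * n + 1) → ℂ) (t : ℝ) :
    numAt i (s, y + t • X) = numAt i (s, y) + t * dnum i X s := by
  have := insertOne_add i y X t
  rw [Complex.coe_smul] at this
  rw [numAt, this, num_add, num_smul, numAt, dnum]

theorem denAt_add (s : ℂ × ℂ) (y X : Fin (2 * n + 1) → ℂ) (t : ℝ) :
    denAt i (s, y + t • X) = denAt i (s, y) + t * dden i X s := by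
  have := insertOne_add i y X t
  rw [Complex.coe_smul] at this
  rw [denAt, this, den_add, den_smul, denAt, dden]

theorem contDiff_numAt : ContDiff ℝ ∞ (numAt i) := by
  unfold numAt num
  have := fun j => (contDiff_insertOne i j).comp (contDiff_snd (𝕜 := ℝ) (E := ℂ × ℂ))
  refine ContDiff.sum fun k _ => ((this _).mul ?_).mul ?_
  · fun_prop
  · fun_prop

theorem contDiff_denAt : ContDiff ℝ ∞ (denAt i) := by
  unfold denAt den
  have := fun j => (contDiff_insertOne i j).comp (contDiff_snd (𝕜 := ℝ) (E := ℂ × ℂ))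
  refine ContDiff.sum fun k _ => ((this _).mul ?_).mul ?_
  · fun_prop
  · fun_prop

theorem contDiff_dnum (X : Fin (2 * n + 1) → ℂ) : ContDiff ℝ ∞ (dnum i X) := by
  unfold dnum num
  fun_prop

theorem contDiff_dden (X : Fin (2 * n + 1) → ℂ) : ContDiff ℝ ∞ (dden i X) := by
  unfold dden den
  fun_prop

/-- Where numerator and denominator do not both vanish. -/
def regularSet : Set ((ℂ × ℂ) × (Fin (2 * n + 1) → ℂ)) := {q | numAt i q ≠ 0 ∨ denAt i q ≠ 0}

theorem isOpen_regularSet : IsOpen (regularSet i) :=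
  (isOpen_ne_fun (contDiff_numAt i).continuous continuous_const).union
    (isOpen_ne_fun (contDiff_denAt i).continuous continuous_const)

/-- The affine coordinates in the `i`-th chart of the rational maps of degree `n`. -/
def degreeSet : Set (Fin (2 * n + 1) → ℂ) := {y | IsDegree (insertOne i y).1}

theorem isOpen_degreeSet : IsOpen (degreeSet i) :=
  (isOpen_isDegree n).preimage (continuous_subtype_val.comp (continuous_insertOne i))

theorem mem_regularSet {i : Fin (2 * n + 1 + 1)} {y : Fin (2 * n + 1) → ℂ} (hy : y ∈ degreeSet i)
    {s : ℂ × ℂ} (hs : s ≠ 0) : (s, y) ∈ regularSet i := by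
  refine (isDegree_iff _).mp hy _ _ ?_
  contrapose! hs
  exact Prod.ext hs.1 hs.2

/-- `|u|² + |v|²` for the numerator `u` and the denominator `v`. -/
noncomputable def normAt (q : (ℂ × ℂ) × (Fin (2 * n + 1) → ℂ)) : ℝ :=
  normSq (numAt i q) + normSq (denAt i q)

theorem contDiff_normSq : ContDiff ℝ ∞ (fun z : ℂ => normSq z) := by
  simp only [normSq_apply]
  have h1 : ContDiff ℝ ∞ (fun z : ℂ => z.re) := reCLM.contDiff
  have h2 : ContDiff ℝ ∞ (fun z : ℂ => z.im) := imCLM.contDiff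
  fun_prop

theorem contDiff_normAt : ContDiff ℝ ∞ (normAt i) :=
  (contDiff_normSq.comp (contDiff_numAt i)).add (contDiff_normSq.comp (contDiff_denAt i))

/-- The evaluation map in the `i`-th chart. -/
noncomputable def evalAt (q : (ℂ × ℂ) × (Fin (2 * n + 1) → ℂ)) : R3 :=
  invStereoVec (numAt i q) (denAt i q)

theorem normAt_ne_zero {i : Fin (2 * n + 1 + 1)} {q : (ℂ × ℂ) × (Fin (2 * n + 1) → ℂ)}
    (hq : q ∈ regularSet i) : normAt i q ≠ 0 := (normSq_add_normSq_pos hq).ne'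

theorem contDiff_mul_conj {f g : (ℂ × ℂ) × (Fin (2 * n + 1) → ℂ) → ℂ} (hf : ContDiff ℝ ∞ f)
    (hg : ContDiff ℝ ∞ g) : ContDiff ℝ ∞ (fun q => f q * starRingEnd ℂ (g q)) :=
  hf.mul (conjCLE.contDiff.comp hg)

theorem contDiffOn_evalAt : ContDiffOn ℝ ∞ (evalAt i) (regularSet i) := by
  rw [contDiffOn_euclidean]
  have hN := (contDiff_normAt i).contDiffOn.inv (s := regularSet i) fun q hq => normAt_ne_zero hq
  have h := contDiff_mul_conj (contDiff_numAt i) (contDiff_denAt i)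
  have h0 := hN.mul ((reCLM.contDiff.comp h).const_smul (2 : ℝ)).contDiffOn
  have h1 := hN.mul ((imCLM.contDiff.comp h).const_smul (2 : ℝ)).contDiffOn
  have h2 := hN.mul ((contDiff_normSq.comp (contDiff_numAt i)).sub
    (contDiff_normSq.comp (contDiff_denAt i))).contDiffOn
  refine Fin.forall_fin_succ.mpr ⟨?_, Fin.forall_fin_two.mpr ⟨?_, ?_⟩⟩
  · refine h0.congr fun q _ => ?_
    simp [evalAt, invStereoVec, normAt, normSq_eq_norm_sq]
  · refine h1.congr fun q _ => ?_
    simp [evalAt, invStereoVec, normAt, normSq_eq_norm_sq]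
  · refine h2.congr fun q _ => ?_
    simp [evalAt, invStereoVec, normAt, normSq_eq_norm_sq]

theorem fderivSnd_evalAt {q : (ℂ × ℂ) × (Fin (2 * n + 1) → ℂ)} (hq : q ∈ regularSet i)
    (X : Fin (2 * n + 1) → ℂ) : fderivSnd (evalAt i) q X =
      hopfDeriv (numAt i q) (denAt i q) (dnum i X q.1) (dden i X q.1) := by
  refine fderivSnd_apply_of_hasDerivAt (isOpen_regularSet i) (contDiffOn_evalAt i) hq ?_
  simp only [evalAt, numAt_add, denAt_add]
  exact hasDerivAt_invStereoVec_line hq _ _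

/-- The pullback of the round metric under the evaluation map. -/
noncomputable def pullMetric (X Y : Fin (2 * n + 1) → ℂ)
    (q : (ℂ × ℂ) × (Fin (2 * n + 1) → ℂ)) : ℝ :=
  inner ℝ (fderivSnd (evalAt i) q X) (fderivSnd (evalAt i) q Y)

theorem contDiffOn_pullMetric (X Y : Fin (2 * n + 1) → ℂ) :
    ContDiffOn ℝ ∞ (pullMetric i X Y) (regularSet i) := by
  have h := (contDiffOn_evalAt i).fderivSnd (isOpen_regularSet i)
  exact (h.clm_apply contDiffOn_const).inner ℝ (h.clm_apply contDiffOn_const)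

/-- The pullback under the evaluation map of a local primitive of the area form of the sphere. -/
noncomputable def potential (X : Fin (2 * n + 1) → ℂ)
    (q : (ℂ × ℂ) × (Fin (2 * n + 1) → ℂ)) : ℝ :=
  2 * potForm (numAt i q) (denAt i q) (dnum i X q.1) (dden i X q.1)

theorem contDiffOn_potential (X : Fin (2 * n + 1) → ℂ) :
    ContDiffOn ℝ ∞ (potential i X) (regularSet i) := by
  have h1 := contDiff_mul_conj ((contDiff_dnum i X).comp contDiff_fst) (contDiff_numAt i)
  have h2 := contDiff_mul_conj ((contDiff_dden i X).comp contDiff_fst) (contDiff_denAt i)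
  have h3 := ((imCLM.contDiff.comp (h1.add h2)).contDiffOn.div
    (contDiff_normAt i).contDiffOn fun q hq => normAt_ne_zero hq).const_smul (2 : ℝ)
  refine h3.congr fun q _ => ?_
  simp [potential, potForm, normAt, mul_comm]

theorem fderivSnd_potential {q : (ℂ × ℂ) × (Fin (2 * n + 1) → ℂ)} (hq : q ∈ regularSet i)
    (X Y : Fin (2 * n + 1) → ℂ) : fderivSnd (potential i Y) q X =
      2 * potFormDeriv (numAt i q) (denAt i q) (dnum i X q.1) (dden i X q.1)
        (dnum i Y q.1) (dden i Y q.1) := by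
  refine fderivSnd_apply_of_hasDerivAt (isOpen_regularSet i) (contDiffOn_potential i Y) hq ?_
  simp only [potential, numAt_add, denAt_add]
  exact (hasDerivAt_potForm_line hq _ _ _ _).const_mul 2

theorem pullMetric_eq {q : (ℂ × ℂ) × (Fin (2 * n + 1) → ℂ)} (hq : q ∈ regularSet i)
    (X Y : Fin (2 * n + 1) → ℂ) : pullMetric i X Y q =
      4 * (wronsk (numAt i q) (denAt i q) (dnum i X q.1) (dden i X q.1) *
        starRingEnd ℂ (wronsk (numAt i q) (denAt i q) (dnum i Y q.1) (dden i Y q.1))).re /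
        normAt i q ^ 2 := by
  rw [pullMetric, fderivSnd_evalAt i hq, fderivSnd_evalAt i hq, inner_hopfDeriv hq, normAt]

theorem dnum_smul (X : Fin (2 * n + 1) → ℂ) (t : ℂ) (s : ℂ × ℂ) :
    dnum i (t • X) s = t * dnum i X s := by
  rw [dnum, insertZero_smul, num_smul, dnum]

theorem dden_smul (X : Fin (2 * n + 1) → ℂ) (t : ℂ) (s : ℂ × ℂ) :
    dden i (t • X) s = t * dden i X s := by
  rw [dden, insertZero_smul, den_smul, dden]

theorem pullMetric_I_smul {q : (ℂ × ℂ) × (Fin (2 * n + 1) → ℂ)} (hq : q ∈ regularSet i)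
    (X Y : Fin (2 * n + 1) → ℂ) : pullMetric i (I • X) (I • Y) q = pullMetric i X Y q := by
  have (u v u' v' : ℂ) : wronsk u v (I * u') (I * v') = I * wronsk u v u' v' := by
    simp only [wronsk]; ring
  rw [pullMetric_eq i hq, pullMetric_eq i hq]
  simp only [dnum_smul, dden_smul, this]
  congr 2
  simp

/-- The pullback of the area form of the sphere is the exterior derivative of `potential`. -/
theorem pullMetric_I_smul_left {q : (ℂ × ℂ) × (Fin (2 * n + 1) → ℂ)} (hq : q ∈ regularSet i)
    (X Y : Fin (2 * n + 1) → ℂ) : pullMetric i (I • X) Y q =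
      fderivSnd (potential i Y) q X - fderivSnd (potential i X) q Y := by
  rw [fderivSnd_potential i hq, fderivSnd_potential i hq, pullMetric_eq i hq, ← mul_sub,
    potFormDeriv_sub hq, dnum_smul, dden_smul, normAt]

end

/-! ### Homogeneous stereographic coordinates of norm one -/

/-- Homogeneous stereographic coordinates, normalised to a unit vector. -/
noncomputable def unitStereo (p : S2) : ℂ × ℂ := ((‖stereo p‖⁻¹ : ℝ) : ℂ) • stereo p

theorem stereo_vec_ne_zero (p : S2) : stereo p ≠ 0 := by
  have := stereo_ne_zero p
  contrapose! this
  simp [this]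

theorem unitStereo_mem_sphere (p : S2) : unitStereo p ∈ sphere (0 : ℂ × ℂ) 1 := by
  rw [mem_sphere_zero_iff_norm, unitStereo, norm_smul, Complex.norm_real, norm_inv, norm_norm,
    inv_mul_cancel₀ (norm_ne_zero_iff.mpr (stereo_vec_ne_zero p))]

theorem measurable_stereo : Measurable stereo := by
  have h : ∀ j : Fin 3, Measurable fun p : S2 => p.1 j := fun j =>
    (show Continuous fun p : S2 => p.1 j by fun_prop).measurable
  have h1 : Measurable fun p : S2 => (⟨p.1 0, p.1 1⟩ : ℂ) := by
    have : Continuous fun p : S2 => (p.1 0 : ℂ) + (p.1 1 : ℂ) * I := by fun_prop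
    simpa [mk_eq_add_mul_I] using this.measurable
  exact Measurable.ite (h 2 (measurableSet_singleton 1)) measurable_const
    (h1.prodMk (measurable_ofReal.comp (measurable_const.sub (h 2))))

theorem measurable_unitStereo : Measurable unitStereo :=
  (measurable_ofReal.comp measurable_stereo.norm.inv).smul measurable_stereo

theorem isCompact_unitSphere : IsCompact (sphere (0 : ℂ × ℂ) 1) := isCompact_sphere 0 1

theorem mem_regularSet_of_mem_sphere {n : ℕ} {i : Fin (2 * n + 1 + 1)}
    {y : Fin (2 * n + 1) → ℂ} (hy : y ∈ degreeSet i) :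
    ∀ s ∈ sphere (0 : ℂ × ℂ) 1, (s, y) ∈ regularSet i := fun s hs =>
  mem_regularSet hy (by rintro rfl; simp at hs)

theorem evalAt_unitStereo {n : ℕ} (i : Fin (2 * n + 1 + 1)) (y : Fin (2 * n + 1) → ℂ) (p : S2) :
    evalAt i (unitStereo p, y) = invStereoVec (num (insertOne i y).1 (stereo p).1 (stereo p).2)
      (den (insertOne i y).1 (stereo p).1 (stereo p).2) := by
  have hne : ((‖stereo p‖⁻¹ : ℝ) : ℂ) ≠ 0 := by
    simpa using stereo_vec_ne_zero p
  simp only [evalAt, numAt, denAt, unitStereo, Prod.smul_fst, Prod.smul_snd, smul_eq_mul,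
    num_scale, den_scale]
  exact invStereoVec_smul (pow_ne_zero n hne) _ _

/-! ### Infinitesimal deformations that fix every value are trivial -/

section

variable {n : ℕ}

theorem natDegree_numPoly_le (a : Fin (2 * n + 1 + 1) → ℂ) : (numPoly a).natDegree ≤ n :=
  Polynomial.natDegree_sum_le_of_forall_le _ _ fun k _ =>
    (Polynomial.natDegree_monomial_le _).trans (by omega)

theorem natDegree_denPoly_le (a : Fin (2 * n + 1 + 1) → ℂ) : (denPoly a).natDegree ≤ n :=
  Polynomial.natDegree_sum_le_of_forall_le _ _ fun k _ =>
    (Polynomial.natDegree_monomial_le _).trans (by omega)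

/-- If `b = b₁ / b₂` and `a = a₁ / a₂` agree as quotients of polynomials and `a` has degree `n`,
then the coefficients of `b` are a multiple of those of `a`. -/
theorem exists_eq_smul_of_cross {a b : Fin (2 * n + 1 + 1) → ℂ} (ha : IsDegree a)
    (h : denPoly a * numPoly b = numPoly a * denPoly b) : ∃ c : ℂ, b = c • a := by
  obtain ⟨u, v, huv⟩ := isCoprime_poly ha
  set C := u * numPoly b + v * denPoly b with hC
  have e1 : numPoly b = numPoly a * C := by
    rw [hC]; linear_combination (-numPoly b) * huv + v * h
  have e2 : denPoly b = denPoly a * C := by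
    rw [hC]; linear_combination (-denPoly b) * huv - u * h
  have hdeg : C.natDegree = 0 := by
    -- Some `n`-th coefficient of `a` is nonzero, so a nonconstant factor would push the degree
    -- above `n`.
    by_contra h0
    have hC0 : C ≠ 0 := by rintro h1; simp [h1] at h0
    rcases ha.1 with h1 | h1
    · have h2 : (numPoly a).coeff n = a ⟨n, by omega⟩ := coeff_numPoly a (Fin.last n)
      have h3 : n ≤ (numPoly a).natDegree :=
        Polynomial.le_natDegree_of_ne_zero (by rw [h2]; exact h1)
      have h4 := natDegree_numPoly_le b
      rw [e1, Polynomial.natDegree_mul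
        (by rintro h5; rw [h5, Polynomial.coeff_zero] at h2; exact h1 h2.symm) hC0] at h4
      omega
    · have h2 : (denPoly a).coeff n = a ⟨n + 1 + n, by omega⟩ := coeff_denPoly a (Fin.last n)
      have h6 : (⟨n + 1 + n, by omega⟩ : Fin (2 * n + 1 + 1)) =
        ⟨2 * n + 1, by omega⟩ := Fin.ext (by simp only; omega)
      rw [h6] at h2
      have h3 : n ≤ (denPoly a).natDegree :=
        Polynomial.le_natDegree_of_ne_zero (by rw [h2]; exact h1)
      have h4 := natDegree_denPoly_le b
      rw [e2, Polynomial.natDegree_mul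
        (by rintro h5; rw [h5, Polynomial.coeff_zero] at h2; exact h1 h2.symm) hC0] at h4
      omega
  rw [Polynomial.eq_C_of_natDegree_eq_zero hdeg] at e1 e2
  refine ⟨C.coeff 0, funext fun j => ?_⟩
  rcases lt_or_ge j.1 (n + 1) with hj | hj
  · have := congrArg (fun p => Polynomial.coeff p j.1) e1
    have g1 := coeff_numPoly a ⟨j.1, hj⟩
    have g2 := coeff_numPoly b ⟨j.1, hj⟩
    simp only [Polynomial.coeff_mul_C, Fin.eta] at this g1 g2
    rw [g1, g2, mul_comm] at this
    exact this
  · have hj2 := j.2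
    have := congrArg (fun p => Polynomial.coeff p (j.1 - (n + 1))) e2
    have g1 := coeff_denPoly a ⟨j.1 - (n + 1), by omega⟩
    have g2 := coeff_denPoly b ⟨j.1 - (n + 1), by omega⟩
    have hjj : (⟨n + 1 + (j.1 - (n + 1)), by omega⟩ : Fin (2 * n + 1 + 1)) = j :=
      Fin.ext (by simp; omega)
    simp only [Polynomial.coeff_mul_C, hjj] at this g1 g2
    rw [g1, g2, mul_comm] at this
    exact this

variable (i : Fin (2 * n + 1 + 1))

/-- The numerator of the infinitesimal deformation `X` of the map with affine coordinates `y`. -/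
noncomputable def wronskAt (X y : Fin (2 * n + 1) → ℂ) (s : ℂ × ℂ) : ℂ :=
  wronsk (numAt i (s, y)) (denAt i (s, y)) (dnum i X s) (dden i X s)

theorem wronskAt_scale (X y : Fin (2 * n + 1) → ℂ) (c z w : ℂ) :
    wronskAt i X y (c * z, c * w) = c ^ (2 * n) * wronskAt i X y (z, w) := by
  simp only [wronskAt, wronsk, numAt, denAt, dnum, dden, num_scale, den_scale]
  ring

theorem continuous_wronskAt (X y : Fin (2 * n + 1) → ℂ) : Continuous (wronskAt i X y) := by
  have h1 := (contDiff_numAt i).continuous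
  have h2 := (contDiff_denAt i).continuous
  have h3 := (contDiff_dnum i X).continuous
  have h4 := (contDiff_dden i X).continuous
  unfold wronskAt wronsk
  fun_prop

/-- If `wronskAt i X y` vanished identically, then `insertZero i X` would be a multiple of
`insertOne i y`; comparing `i`-th entries, the multiple would be zero. -/
theorem exists_wronskAt_ne_zero {X y : Fin (2 * n + 1) → ℂ} (hy : y ∈ degreeSet i) (hX : X ≠ 0) :
    ∃ z : ℂ, wronskAt i X y (z, 1) ≠ 0 := by
  by_contra! h
  obtain ⟨c, hc⟩ := exists_eq_smul_of_cross (b := insertZero i X) hy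
    (Polynomial.funext fun z => by
      simpa [wronskAt, wronsk, numAt, denAt, dnum, dden, sub_eq_zero] using h z)
  have h0 := congrFun hc i
  have : c = 0 := by simpa [insertZero, insertOne] using h0.symm
  exact insertZero_ne_zero hX (by rw [hc, this, zero_smul])

/-! ### The metric in affine coordinates -/

/-- The `L²` inner product in the `i`-th chart. -/
noncomputable def metricAt (X Y y : Fin (2 * n + 1) → ℂ) : ℝ :=
  ∫ p, pullMetric i X Y (unitStereo p, y) ∂area

instance : IsFiniteMeasure area := inferInstanceAs (IsFiniteMeasure (volume : Measure R3).toSphere)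

instance : area.IsOpenPosMeasure :=
  inferInstanceAs (volume : Measure R3).toSphere.IsOpenPosMeasure

theorem integrable_pullMetric (X Y : Fin (2 * n + 1) → ℂ) {y : Fin (2 * n + 1) → ℂ}
    (hy : y ∈ degreeSet i) : Integrable (fun p => pullMetric i X Y (unitStereo p, y)) area :=
  integrable_comp_prodMk isCompact_unitSphere measurable_unitStereo unitStereo_mem_sphere
    (contDiffOn_pullMetric i X Y).continuousOn (mem_regularSet_of_mem_sphere hy)

theorem integrable_potential (X : Fin (2 * n + 1) → ℂ) {y : Fin (2 * n + 1) → ℂ}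
    (hy : y ∈ degreeSet i) : Integrable (fun p => potential i X (unitStereo p, y)) area :=
  integrable_comp_prodMk isCompact_unitSphere measurable_unitStereo unitStereo_mem_sphere
    (contDiffOn_potential i X).continuousOn (mem_regularSet_of_mem_sphere hy)

theorem contDiffOn_metricAt (X Y : Fin (2 * n + 1) → ℂ) :
    ContDiffOn ℝ ∞ (metricAt i X Y) (degreeSet i) :=
  contDiffOn_integral_comp isCompact_unitSphere measurable_unitStereo unitStereo_mem_sphere
    (isOpen_regularSet i) (isOpen_degreeSet i)
    (fun s hs _ hy => mem_regularSet_of_mem_sphere hy s hs) (contDiffOn_pullMetric i X Y)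

theorem pullMetric_self_pos {X y : Fin (2 * n + 1) → ℂ} {s : ℂ × ℂ} (hs : (s, y) ∈ regularSet i)
    (h : wronskAt i X y s ≠ 0) : 0 < pullMetric i X X (s, y) := by
  rw [pullMetric_eq i hs, mul_conj, ofReal_re]
  have h1 := normSq_pos.mpr h
  have h2 := normAt_ne_zero hs
  rw [wronskAt] at h1
  positivity

/-- A nonzero deformation moves the values on a nonempty open subset of the sphere. -/
theorem metricAt_self_pos {X y : Fin (2 * n + 1) → ℂ} (hy : y ∈ degreeSet i) (hX : X ≠ 0) :
    0 < metricAt i X X y := by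
  -- Off the north pole, stereographic coordinates are continuous.
  let O : Set S2 := {p | p.1 2 ≠ 1} ∩
    {p | wronskAt i X y (p.1 0 + p.1 1 * I, ((1 - p.1 2 : ℝ) : ℂ)) ≠ 0}
  have hO : IsOpen O := by
    refine (isOpen_ne_fun (by fun_prop) continuous_const).inter
      (isOpen_ne_fun ((continuous_wronskAt i X y).comp (by fun_prop)) continuous_const)
  have hst : ∀ p : S2, p.1 2 ≠ 1 →
      stereo p = (p.1 0 + p.1 1 * I, ((1 - p.1 2 : ℝ) : ℂ)) := fun p hp => by
    rw [stereo, if_neg hp, mk_eq_add_mul_I]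
  have hne : O.Nonempty := by
    obtain ⟨z, hz⟩ := exists_wronskAt_ne_zero i hy hX
    obtain ⟨c, hc, h1, h2⟩ := stereo_invStereo z
    have hp : (invStereo z 1 (by simp)).1 2 ≠ 1 := by
      intro h
      rw [stereo, if_pos h] at h2
      exact hc (by simpa using h2.symm)
    refine ⟨invStereo z 1 (by simp), hp, ?_⟩
    rw [mem_ofPred_eq, ← hst _ hp, ← Prod.mk.eta (p := stereo _), h1, h2, wronskAt_scale]
    exact mul_ne_zero (pow_ne_zero _ hc) hz
  have hsub : O ⊆ Function.support fun p => pullMetric i X X (unitStereo p, y) := by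
    rintro p ⟨hp1, hp2⟩
    rw [mem_ofPred_eq, ← hst p hp1] at hp2
    refine (pullMetric_self_pos i
      (mem_regularSet_of_mem_sphere hy _ (unitStereo_mem_sphere p)) ?_).ne'
    have : unitStereo p = (((‖stereo p‖⁻¹ : ℝ) : ℂ) * (stereo p).1,
      ((‖stereo p‖⁻¹ : ℝ) : ℂ) * (stereo p).2) := rfl
    rw [this, wronskAt_scale]
    refine mul_ne_zero (pow_ne_zero _ ?_) hp2
    simpa using stereo_vec_ne_zero p
  rw [metricAt, integral_pos_iff_support_of_nonneg
    (f := fun p => pullMetric i X X (unitStereo p, y))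
    (fun p => real_inner_self_nonneg)
    (integrable_pullMetric i X X hy)]
  exact (hO.measure_pos area hne).trans_le (measure_mono hsub)

theorem metricAt_comm (X Y y : Fin (2 * n + 1) → ℂ) : metricAt i X Y y = metricAt i Y X y := by
  simp only [metricAt, pullMetric, real_inner_comm]

theorem metricAt_add_left (X X' Y : Fin (2 * n + 1) → ℂ) {y : Fin (2 * n + 1) → ℂ}
    (hy : y ∈ degreeSet i) : metricAt i (X + X') Y y = metricAt i X Y y + metricAt i X' Y y := by
  rw [metricAt, metricAt, metricAt, ← integral_add (integrable_pullMetric i X Y hy)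
    (integrable_pullMetric i X' Y hy)]
  simp only [pullMetric, map_add, inner_add_left]

theorem metricAt_smul_left (c : ℝ) (X Y y : Fin (2 * n + 1) → ℂ) :
    metricAt i (c • X) Y y = c * metricAt i X Y y := by
  rw [metricAt, metricAt, ← integral_const_mul]
  simp only [pullMetric, map_smul, real_inner_smul_left]

theorem metricAt_I_smul (X Y : Fin (2 * n + 1) → ℂ) {y : Fin (2 * n + 1) → ℂ}
    (hy : y ∈ degreeSet i) : metricAt i (I • X) (I • Y) y = metricAt i X Y y :=
  integral_congr_ae (.of_forall fun p => pullMetric_I_smul i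
    (mem_regularSet_of_mem_sphere hy _ (unitStereo_mem_sphere p)) X Y)

/-- The integral over the sphere of the primitives of the pulled back area forms. -/
theorem exists_integral_potential {y : Fin (2 * n + 1) → ℂ} (hy : y ∈ degreeSet i) :
    ∃ A : (Fin (2 * n + 1) → ℂ) →L[ℝ] ℝ,
      ∀ X, A X = ∫ p, potential i X (unitStereo p, y) ∂area := by
  refine ⟨LinearMap.toContinuousLinearMap
    { toFun := fun X => ∫ p, potential i X (unitStereo p, y) ∂area
      map_add' := fun X Y => ?_
      map_smul' := fun c X => ?_ }, fun X => rfl⟩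
  · rw [← integral_add (integrable_potential i X hy) (integrable_potential i Y hy)]
    congr with p
    simp only [potential, potForm, dnum, dden, insertZero_add, num_add, den_add, mul_add, add_im]
    ring
  · rw [RingHom.id_apply, smul_eq_mul, ← integral_const_mul]
    congr with p
    simp only [potential, potForm, ← Complex.coe_smul, dnum_smul, dden_smul,
      mul_left_comm _ (c : ℂ), ← mul_add, im_ofReal_mul]
    ring

/-- The fundamental form in the `i`-th chart is the exterior derivative of the integrated
primitives, hence closed. -/
theorem exists_closed_form : ∃ Ω : (Fin (2 * n + 1) → ℂ) → (Fin (2 * n + 1) → ℂ) [⋀^Fin 2]→L[ℝ] ℝ,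
    (∀ y ∈ degreeSet i, ∀ v w, Ω y ![v, w] = metricAt i (I • v) w y) ∧
    ∀ y ∈ degreeSet i, extDeriv Ω y = 0 := by
  choose! A hA using fun y (hy : y ∈ degreeSet i) => exists_integral_potential i hy
  have hAd : ContDiffOn ℝ ∞ A (degreeSet i) := by
    rw [contDiffOn_clm_apply]
    intro X
    exact (contDiffOn_integral_comp isCompact_unitSphere measurable_unitStereo
      unitStereo_mem_sphere (isOpen_regularSet i) (isOpen_degreeSet i)
      (fun s hs _ hy => mem_regularSet_of_mem_sphere hy s hs) (contDiffOn_potential i X)).congr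
      fun y hy => hA y hy X
  let L := ContinuousAlternatingMap.ofSubsingletonLIE (𝕜 := ℝ)
    (E := Fin (2 * n + 1) → ℂ) (F := ℝ) (i := (0 : Fin 1))
  have hLd : ContDiffOn ℝ ∞ (fun y => L (A y)) (degreeSet i) :=
    L.toContinuousLinearEquiv.contDiff.comp_contDiffOn hAd
  have hLat : ∀ y ∈ degreeSet i, ContDiffAt ℝ ∞ (fun y => L (A y)) y := fun y hy =>
    hLd.contDiffAt ((isOpen_degreeSet i).mem_nhds hy)
  refine ⟨extDeriv fun y => L (A y), fun y hy v w => ?_, fun y hy => ?_⟩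
  · have hder : ∀ v w, fderiv ℝ (fun y => A y v) y w =
        ∫ p, fderivSnd (potential i v) (unitStereo p, y) w ∂area := by
      intro v w
      rw [← fderiv_integral_comp_apply isCompact_unitSphere measurable_unitStereo
        unitStereo_mem_sphere (isOpen_regularSet i) (contDiffOn_potential i v)
        (mem_regularSet_of_mem_sphere hy)]
      congr 1
      refine Filter.EventuallyEq.fderiv_eq ?_
      filter_upwards [(isOpen_degreeSet i).mem_nhds hy] with y' hy' using hA y' hy' v
    have hint : ∀ v w,
        Integrable (fun p => fderivSnd (potential i v) (unitStereo p, y) w) area := fun v w =>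
      integrable_comp_prodMk (h := fun q => fderivSnd (potential i v) q w) isCompact_unitSphere
        measurable_unitStereo unitStereo_mem_sphere
        (((contDiffOn_potential i v).fderivSnd (isOpen_regularSet i)).clm_apply
          contDiffOn_const).continuousOn (mem_regularSet_of_mem_sphere hy)
    rw [extDeriv_apply ((hLat y hy).differentiableAt (by simp))]
    simp [L, Fin.sum_univ_two, Fin.removeNth]
    rw [hder, hder, metricAt, ← sub_eq_add_neg, ← integral_sub (hint w v) (hint v w)]
    refine integral_congr_ae (.of_forall fun p => (pullMetric_I_smul_left i
      (mem_regularSet_of_mem_sphere hy _ (unitStereo_mem_sphere p)) v w).symm)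
  · exact extDeriv_extDeriv_apply (hLat y hy) (by
      rw [minSmoothness_of_isRCLikeNormedField]
      exact ENat.LEInfty.out)

end

/-! ### Bilinear forms on finite dimensional spaces -/

theorem exists_clm_of_symm_bilinear {E : Type*} [NormedAddCommGroup E] [NormedSpace ℝ E]
    [FiniteDimensional ℝ E] (f : E → E → ℝ) (hsymm : ∀ v w, f v w = f w v)
    (hadd : ∀ v v' w, f (v + v') w = f v w + f v' w)
    (hsmul : ∀ (c : ℝ) v w, f (c • v) w = c * f v w) :
    ∃ B : E →L[ℝ] E →L[ℝ] ℝ, ∀ v w, B v w = f v w := by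
  let b : E →ₗ[ℝ] E →ₗ[ℝ] ℝ := LinearMap.mk₂ ℝ f hadd hsmul
    (fun v w w' => by rw [hsymm, hadd, hsymm w, hsymm w'])
    (fun c v w => by rw [hsymm, hsmul, hsymm w, smul_eq_mul])
  exact ⟨LinearMap.toContinuousLinearMap
    ((LinearMap.toContinuousLinearMap : (E →ₗ[ℝ] ℝ) ≃ₗ[ℝ] (E →L[ℝ] ℝ)).toLinearMap ∘ₗ b),
    fun v w => rfl⟩

/-- The open unit ball of a scalar product on a finite dimensional space is bounded. -/
theorem isVonNBounded_of_pos {E : Type*} [NormedAddCommGroup E] [NormedSpace ℝ E]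
    [FiniteDimensional ℝ E] (B : E →L[ℝ] E →L[ℝ] ℝ) (hB : ∀ v, v ≠ 0 → 0 < B v v) :
    Bornology.IsVonNBounded ℝ {v : E | B v v < 1} := by
  rw [NormedSpace.isVonNBounded_iff]
  rcases (sphere (0 : E) 1).eq_empty_or_nonempty with h | h
  · refine (Bornology.isBounded_singleton (x := (0 : E))).subset fun v _ => ?_
    by_contra hv
    have : (‖v‖⁻¹ • v) ∈ sphere (0 : E) 1 := by
      have hv' : v ≠ 0 := hv
      simp [norm_smul, hv']
    simp [h] at this
  · have hcont : Continuous fun v => B v v := B.continuous.clm_apply continuous_id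
    obtain ⟨u, hu, hmin⟩ := (isCompact_sphere (0 : E) 1).exists_isMinOn h hcont.continuousOn
    have hu0 : u ≠ 0 := by rintro rfl; simp at hu
    have hc := hB u hu0
    refine (isBounded_iff_forall_norm_le).mpr ⟨1 + (B u u)⁻¹, fun v (hv : B v v < 1) => ?_⟩
    rcases eq_or_ne v 0 with rfl | hv0
    · simp; positivity
    have hn : 0 < ‖v‖ := norm_pos_iff.mpr hv0
    have h1 : B u u ≤ B (‖v‖⁻¹ • v) (‖v‖⁻¹ • v) :=
      hmin (by simp [norm_smul, hv0])
    simp only [map_smul, _root_.smul_apply, smul_eq_mul] at h1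
    have h2 : B u u * ‖v‖ ^ 2 < 1 := by
      calc B u u * ‖v‖ ^ 2 ≤ (‖v‖⁻¹ * (‖v‖⁻¹ * B v v)) * ‖v‖ ^ 2 := by gcongr
        _ = B v v := by field_simp
        _ < 1 := hv
    have h3 : ‖v‖ ^ 2 < (B u u)⁻¹ := by
      rwa [lt_inv_comm₀ (by positivity) hc, ← one_div, lt_div_iff₀ (by positivity)]
    nlinarith

/-! ### Complex differentials as real differentials -/

section Kaehler

variable {E : Type*} [NormedAddCommGroup E] [NormedSpace ℂ E] [NormedSpace ℝ E]
  [IsScalarTower ℝ ℂ E] {M : Type*} [TopologicalSpace M] [ChartedSpace E M]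

/-- Inverse charts of a complex manifold are holomorphic: their real differentials intertwine
multiplication by `i` and the almost complex structure. -/
theorem J_mfderiv_symm [IsManifold 𝓘(ℂ, E) ω M] {e : OpenPartialHomeomorph M E}
    (he : e ∈ atlas E M) {y : E} (hy : y ∈ e.target) (v : E) :
    J (e.symm y) (mfderiv 𝓘(ℝ, E) 𝓘(ℝ, E) e.symm y v) =
      mfderiv 𝓘(ℝ, E) 𝓘(ℝ, E) e.symm y (I • v : E) := by
  have : IsManifold 𝓘(ℂ, E) 1 M := .of_le (n := ω) le_top
  have h := ((mdifferentiable_of_mem_atlas (I := 𝓘(ℂ, E)) he).mdifferentiableAt_symm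
    hy).hasMFDerivAt
  let D : E →L[ℂ] E := mfderiv 𝓘(ℂ, E) 𝓘(ℂ, E) e.symm y
  have h' : HasMFDerivAt 𝓘(ℝ, E) 𝓘(ℝ, E) e.symm y (D.restrictScalars ℝ : E →L[ℝ] E) := by
    refine ⟨h.1, ?_⟩
    have h2 : HasFDerivWithinAt (𝕜 := ℂ) (writtenInExtChartAt 𝓘(ℂ, E) 𝓘(ℂ, E) y e.symm) D
      (range 𝓘(ℂ, E)) (extChartAt 𝓘(ℂ, E) y y) := h.2
    exact h2.restrictScalars ℝ
  rw [h'.mfderiv]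
  exact (D.map_smul I v).symm

end Kaehler

/-! ### The evaluation maps in charts -/

section

variable {n : ℕ}

theorem toMap_val_of_eq {φ : RationalMaps n} {a : {a : Fin (2 * n + 1 + 1) → ℂ // a ≠ 0}}
    (h : φ.1 = proj _ a) (p : S2) : (toMap φ p : R3) =
      invStereoVec (num a.1 (stereo p).1 (stereo p).2) (den a.1 (stereo p).1 (stereo p).2) := by
  obtain ⟨x, hx⟩ := φ
  subst h
  rfl

/-- Every chart of the atlas is the restriction of some affine chart of projective space. -/
theorem exists_chart_index {e : OpenPartialHomeomorph (RationalMaps n) (Fin (2 * n + 1) → ℂ)}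
    (he : e ∈ atlas (Fin (2 * n + 1) → ℂ) (RationalMaps n)) : ∃ i : Fin (2 * n + 1 + 1),
      ∀ y ∈ e.target, y ∈ degreeSet i ∧
        ∀ p, (toMap (e.symm y) p : R3) = evalAt i (unitStereo p, y) := by
  rcases isEmpty_or_nonempty (RationalMaps n) with h | h
  · exact ⟨0, fun y hy => (h.false (e.symm y)).elim⟩
  obtain ⟨x, rfl⟩ := TopologicalSpace.Opens.chart_eq h he
  refine ⟨(exists_mem_affineSet (x : CP (2 * n + 1))).choose, fun y hy => ?_⟩
  set i := (exists_mem_affineSet (x : CP (2 * n + 1))).choose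
  have h1 := OpenPartialHomeomorph.subtypeRestr_symm_apply
    (chartAt (Fin (2 * n + 1) → ℂ) (x : CP (2 * n + 1))) h hy
  have h2 : (((chartAt (Fin (2 * n + 1) → ℂ) (x : CP (2 * n + 1))).subtypeRestr h).symm y).1 =
    proj _ (insertOne i y) := h1
  refine ⟨?_, fun p => ?_⟩
  · have h3 := (((chartAt (Fin (2 * n + 1) → ℂ)
      (x : CP (2 * n + 1))).subtypeRestr h).symm y).2
    rw [h2] at h3
    exact h3
  · rw [toMap_val_of_eq h2, evalAt_unitStereo]

theorem contDiffOn_evalAt_unitStereo (i : Fin (2 * n + 1 + 1)) (p : S2) :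
    ContDiffOn ℝ ∞ (fun y => evalAt i (unitStereo p, y)) (degreeSet i) :=
  (contDiffOn_evalAt i).comp (by fun_prop) fun _ hy =>
    mem_regularSet_of_mem_sphere hy _ (unitStereo_mem_sphere p)

theorem contMDiff_toMap (p : S2) : ContMDiff 𝓘(ℝ, Fin (2 * n + 1) → ℂ) 𝓘(ℝ, R3) ∞
      (fun φ : RationalMaps n => (toMap φ p : R3)) := by
  intro φ
  let e := chartAt (Fin (2 * n + 1) → ℂ) φ
  obtain ⟨i, hi⟩ := exists_chart_index (chart_mem_atlas _ φ)
  have h1 : ContMDiffAt 𝓘(ℝ, Fin (2 * n + 1) → ℂ) 𝓘(ℝ, Fin (2 * n + 1) → ℂ) ∞ e φ :=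
    contMDiffOn_chart.contMDiffAt (e.open_source.mem_nhds (mem_chart_source _ φ))
  have h2 : ContDiffAt ℝ ∞ (fun y => evalAt i (unitStereo p, y)) (e φ) :=
    (contDiffOn_evalAt_unitStereo i p).contDiffAt ((isOpen_degreeSet i).mem_nhds
      (hi _ (mem_chart_target _ φ)).1)
  refine (h2.contMDiffAt.comp φ h1).congr_of_eventuallyEq ?_
  filter_upwards [e.open_source.mem_nhds (mem_chart_source _ φ)] with ψ hψ
  have := (hi (e ψ) (e.map_source hψ)).2 p
  rw [e.left_inv hψ] at this
  exact this

variable {e : OpenPartialHomeomorph (RationalMaps n) (Fin (2 * n + 1) → ℂ)}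
  {i : Fin (2 * n + 1 + 1)}

theorem mdifferentiable_of_mem_atlas_rationalMaps
    (he : e ∈ atlas (Fin (2 * n + 1) → ℂ) (RationalMaps n)) :
    e.MDifferentiable 𝓘(ℝ, Fin (2 * n + 1) → ℂ) 𝓘(ℝ, Fin (2 * n + 1) → ℂ) := by
  have : IsManifold 𝓘(ℝ, Fin (2 * n + 1) → ℂ) 1 (RationalMaps n) := .of_le (n := ω) le_top
  exact mdifferentiable_of_mem_atlas he

/-- In a chart, `variation` is the coordinate derivative of the evaluation map. -/
theorem variation_mfderiv_symm (he : e ∈ atlas (Fin (2 * n + 1) → ℂ) (RationalMaps n))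
    (hi : ∀ y ∈ e.target, y ∈ degreeSet i ∧
        ∀ p, (toMap (e.symm y) p : R3) = evalAt i (unitStereo p, y))
    {y : Fin (2 * n + 1) → ℂ} (hy : y ∈ e.target) (v : Fin (2 * n + 1) → ℂ) (p : S2) :
    variation (e.symm y)
      (mfderiv 𝓘(ℝ, Fin (2 * n + 1) → ℂ) 𝓘(ℝ, Fin (2 * n + 1) → ℂ) e.symm y v) p =
      fderivSnd (evalAt i) (unitStereo p, y) v := by
  have h1 := ((mdifferentiable_of_mem_atlas_rationalMaps he).mdifferentiableAt_symm hy).hasMFDerivAt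
  have h2 := ((contMDiff_toMap (n := n) p (e.symm y)).mdifferentiableAt (by simp)).hasMFDerivAt
  let D : (Fin (2 * n + 1) → ℂ) →L[ℝ] R3 :=
    (mfderiv 𝓘(ℝ, Fin (2 * n + 1) → ℂ) 𝓘(ℝ, R3) (fun φ : RationalMaps n => (toMap φ p : R3))
      (e.symm y)).comp (mfderiv 𝓘(ℝ, Fin (2 * n + 1) → ℂ) 𝓘(ℝ, Fin (2 * n + 1) → ℂ) e.symm y)
  have h3 : HasFDerivAt ((fun φ : RationalMaps n => (toMap φ p : R3)) ∘ e.symm) D y :=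
    (h2.comp y h1).hasFDerivAt
  have h4 := hasFDerivAt_fderivSnd (isOpen_regularSet i) (contDiffOn_evalAt i)
    (mem_regularSet_of_mem_sphere (hi y hy).1 _ (unitStereo_mem_sphere p))
  have h5 : ((fun φ : RationalMaps n => (toMap φ p : R3)) ∘ e.symm) =ᶠ[nhds y]
      fun y => evalAt i (unitStereo p, y) := by
    filter_upwards [e.open_target.mem_nhds hy] with y' hy' using (hi y' hy').2 p
  have h6 := h3.unique (h4.congr_of_eventuallyEq h5)
  exact congrArg (fun L : (Fin (2 * n + 1) → ℂ) →L[ℝ] R3 => L v) h6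

theorem l2Inner_mfderiv_symm (he : e ∈ atlas (Fin (2 * n + 1) → ℂ) (RationalMaps n))
    (hi : ∀ y ∈ e.target, y ∈ degreeSet i ∧
        ∀ p, (toMap (e.symm y) p : R3) = evalAt i (unitStereo p, y))
    {y : Fin (2 * n + 1) → ℂ} (hy : y ∈ e.target) (v w : Fin (2 * n + 1) → ℂ) :
    l2Inner (e.symm y)
      (mfderiv 𝓘(ℝ, Fin (2 * n + 1) → ℂ) 𝓘(ℝ, Fin (2 * n + 1) → ℂ) e.symm y v)
      (mfderiv 𝓘(ℝ, Fin (2 * n + 1) → ℂ) 𝓘(ℝ, Fin (2 * n + 1) → ℂ) e.symm y w) =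
      metricAt i v w y := by
  simp only [l2Inner, variation_mfderiv_symm he hi hy, metricAt, pullMetric]

/-- Every tangent vector is given by its coordinates in a chart. -/
theorem exists_mfderiv_symm_eq (he : e ∈ atlas (Fin (2 * n + 1) → ℂ) (RationalMaps n))
    {y : Fin (2 * n + 1) → ℂ} (hy : y ∈ e.target)
    (X : TangentSpace 𝓘(ℝ, Fin (2 * n + 1) → ℂ) (e.symm y)) : ∃ v : Fin (2 * n + 1) → ℂ,
      mfderiv 𝓘(ℝ, Fin (2 * n + 1) → ℂ) 𝓘(ℝ, Fin (2 * n + 1) → ℂ) e.symm y v = X :=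
  ((mdifferentiable_of_mem_atlas_rationalMaps he).symm.mfderiv_bijective hy).2 X

theorem exists_chart_coordinates (φ : RationalMaps n) :
    ∃ e ∈ atlas (Fin (2 * n + 1) → ℂ) (RationalMaps n), ∃ y ∈ e.target, φ = e.symm y :=
  ⟨_, chart_mem_atlas _ φ, _, mem_chart_target _ φ,
    ((chartAt (Fin (2 * n + 1) → ℂ) φ).left_inv (mem_chart_source _ φ)).symm⟩

theorem integrable_inner_variation (φ : RationalMaps n)
    (X Y : TangentSpace 𝓘(ℝ, Fin (2 * n + 1) → ℂ) φ) :
    Integrable (fun p => inner ℝ (variation φ X p) (variation φ Y p)) area := by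
  obtain ⟨e, he, y, hy, rfl⟩ := exists_chart_coordinates φ
  obtain ⟨i, hi⟩ := exists_chart_index he
  obtain ⟨v, rfl⟩ := exists_mfderiv_symm_eq he hy X
  obtain ⟨w, rfl⟩ := exists_mfderiv_symm_eq he hy Y
  simp only [variation_mfderiv_symm he hi hy]
  exact integrable_pullMetric i v w (hi y hy).1

theorem l2Inner_self_pos (φ : RationalMaps n) (X : TangentSpace 𝓘(ℝ, Fin (2 * n + 1) → ℂ) φ)
    (hX : X ≠ 0) : 0 < l2Inner φ X X := by
  obtain ⟨e, he, y, hy, rfl⟩ := exists_chart_coordinates φ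
  obtain ⟨i, hi⟩ := exists_chart_index he
  obtain ⟨v, rfl⟩ := exists_mfderiv_symm_eq he hy X
  rw [l2Inner_mfderiv_symm he hi hy]
  refine metricAt_self_pos i (hi y hy).1 ?_
  rintro rfl
  exact hX (map_zero _)

theorem l2Inner_J (φ : RationalMaps n) (X Y : TangentSpace 𝓘(ℝ, Fin (2 * n + 1) → ℂ) φ) :
    l2Inner φ (J φ X) (J φ Y) = l2Inner φ X Y := by
  obtain ⟨e, he, y, hy, rfl⟩ := exists_chart_coordinates φ
  obtain ⟨i, hi⟩ := exists_chart_index he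
  obtain ⟨v, rfl⟩ := exists_mfderiv_symm_eq he hy X
  obtain ⟨w, rfl⟩ := exists_mfderiv_symm_eq he hy Y
  rw [J_mfderiv_symm he hy, J_mfderiv_symm he hy, l2Inner_mfderiv_symm he hi hy,
    l2Inner_mfderiv_symm he hi hy, metricAt_I_smul i _ _ (hi y hy).1]

theorem l2Inner_comm (φ : RationalMaps n) (X Y : TangentSpace 𝓘(ℝ, Fin (2 * n + 1) → ℂ) φ) :
    l2Inner φ X Y = l2Inner φ Y X := by
  simp only [l2Inner, real_inner_comm]

theorem variation_add (φ : RationalMaps n) (X Y : TangentSpace 𝓘(ℝ, Fin (2 * n + 1) → ℂ) φ)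
    (p : S2) : variation φ (X + Y) p = variation φ X p + variation φ Y p :=
  map_add _ X Y

theorem variation_smul (φ : RationalMaps n) (c : ℝ)
    (X : TangentSpace 𝓘(ℝ, Fin (2 * n + 1) → ℂ) φ) (p : S2) :
    variation φ (c • X) p = c • variation φ X p :=
  map_smul _ c X

theorem l2Inner_add_left (φ : RationalMaps n)
    (X X' Y : TangentSpace 𝓘(ℝ, Fin (2 * n + 1) → ℂ) φ) :
    l2Inner φ (X + X') Y = l2Inner φ X Y + l2Inner φ X' Y := by
  simp only [l2Inner, variation_add, inner_add_left]
  exact integral_add (integrable_inner_variation φ X Y) (integrable_inner_variation φ X' Y)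

theorem l2Inner_smul_left (φ : RationalMaps n) (c : ℝ)
    (X Y : TangentSpace 𝓘(ℝ, Fin (2 * n + 1) → ℂ) φ) :
    l2Inner φ (c • X) Y = c * l2Inner φ X Y := by
  simp only [l2Inner, variation_smul, real_inner_smul_left, integral_const_mul]

theorem exists_clm_l2Inner (φ : RationalMaps n) :
    ∃ B : TangentSpace 𝓘(ℝ, Fin (2 * n + 1) → ℂ) φ →L[ℝ]
      TangentSpace 𝓘(ℝ, Fin (2 * n + 1) → ℂ) φ →L[ℝ] ℝ, ∀ X Y, B X Y = l2Inner φ X Y :=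
  exists_clm_of_symm_bilinear (E := Fin (2 * n + 1) → ℂ) (l2Inner φ) (l2Inner_comm φ)
    (l2Inner_add_left φ) (l2Inner_smul_left φ)

/-- A family of scalar products on the tangent spaces that represents the `L²` inner product is
a smooth section. -/
theorem contMDiff_of_eq_l2Inner (B : ∀ φ : RationalMaps n,
      TangentSpace 𝓘(ℝ, Fin (2 * n + 1) → ℂ) φ →L[ℝ]
        TangentSpace 𝓘(ℝ, Fin (2 * n + 1) → ℂ) φ →L[ℝ] ℝ)
    (hB : ∀ φ X Y, B φ X Y = l2Inner φ X Y) :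
    ContMDiff 𝓘(ℝ, Fin (2 * n + 1) → ℂ) (𝓘(ℝ, Fin (2 * n + 1) → ℂ).prod
      𝓘(ℝ, (Fin (2 * n + 1) → ℂ) →L[ℝ] (Fin (2 * n + 1) → ℂ) →L[ℝ] ℝ)) ∞
      (fun φ => TotalSpace.mk' ((Fin (2 * n + 1) → ℂ) →L[ℝ] (Fin (2 * n + 1) → ℂ) →L[ℝ] ℝ)
        (E := fun φ : RationalMaps n => TangentSpace 𝓘(ℝ, Fin (2 * n + 1) → ℂ) φ →L[ℝ]
          TangentSpace 𝓘(ℝ, Fin (2 * n + 1) → ℂ) φ →L[ℝ] ℝ) φ (B φ)) := by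
  intro φ
  rw [contMDiffAt_hom_bundle]
  refine ⟨contMDiffAt_id, ?_⟩
  let e := chartAt (Fin (2 * n + 1) → ℂ) φ
  have he : e ∈ atlas _ _ := chart_mem_atlas _ φ
  obtain ⟨i, hi⟩ := exists_chart_index he
  have hex : ∀ y ∈ degreeSet i, ∃ G : (Fin (2 * n + 1) → ℂ) →L[ℝ] (Fin (2 * n + 1) → ℂ) →L[ℝ] ℝ,
      ∀ v w, G v w = metricAt i v w y := fun y hy =>
    exists_clm_of_symm_bilinear _ (fun v w => metricAt_comm i v w y)
      (fun v v' w => metricAt_add_left i v v' w hy) (fun c v w => metricAt_smul_left i c v w y)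
  choose! G hG using hex
  have hGd : ContDiffOn ℝ ∞ G (degreeSet i) := by
    rw [contDiffOn_clm_apply]
    intro v
    rw [contDiffOn_clm_apply]
    intro w
    exact (contDiffOn_metricAt i v w).congr fun y hy => hG y hy v w
  have h1 : ContMDiffAt 𝓘(ℝ, Fin (2 * n + 1) → ℂ) 𝓘(ℝ, Fin (2 * n + 1) → ℂ) ∞ e φ :=
    contMDiffOn_chart.contMDiffAt (e.open_source.mem_nhds (mem_chart_source _ φ))
  have h2 : ContDiffAt ℝ ∞ G (e φ) := hGd.contDiffAt ((isOpen_degreeSet i).mem_nhds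
      (hi _ (mem_chart_target _ φ)).1)
  refine (h2.contMDiffAt.comp φ h1).congr_of_eventuallyEq ?_
  filter_upwards [e.open_source.mem_nhds (mem_chart_source _ φ)] with ψ hψ
  have hy := e.map_source hψ
  have hbase : ψ ∈ (trivializationAt (Fin (2 * n + 1) → ℂ)
      (TangentSpace 𝓘(ℝ, Fin (2 * n + 1) → ℂ)) φ).baseSet := hψ
  have hsymm : ∀ v : Fin (2 * n + 1) → ℂ,
      (trivializationAt (Fin (2 * n + 1) → ℂ) (TangentSpace 𝓘(ℝ, Fin (2 * n + 1) → ℂ)) φ).symm ψ v =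
      mfderiv 𝓘(ℝ, Fin (2 * n + 1) → ℂ) 𝓘(ℝ, Fin (2 * n + 1) → ℂ) e.symm (e ψ) v := by
    intro v
    have := TangentBundle.symmL_trivializationAt (I := 𝓘(ℝ, Fin (2 * n + 1) → ℂ)) hψ
    rw [← Trivialization.symmL_apply (R := ℝ) _ hbase, this]
    simp only [mfld_simps]
    rfl
  -- In the trivialization at `φ` the section is the coordinate expression `G` of the metric.
  ext v w
  rw [inCoordinates_apply_eq₂ hbase hbase (mem_univ _)]
  have h3 := l2Inner_mfderiv_symm he hi hy v w
  simp only [hsymm, Function.comp, hG _ (hi _ hy).1, ← h3, ← hB]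
  simp only [Trivial.fiberBundle_trivializationAt', Trivial.linearMapAt_trivialization]
  rw [e.left_inv hψ]
  rfl

end

end RatMap

theorem theorem2p1 (n : ℕ) (hn : 0 < n) :
    (∀ p : S2, ContMDiff 𝓘(ℝ, Fin (2 * n + 1) → ℂ) 𝓘(ℝ, R3) ∞
      (fun φ : RationalMaps n => (toMap φ p : R3))) ∧
    (∀ (φ : RationalMaps n) (X Y : TangentSpace 𝓘(ℝ, Fin (2 * n + 1) → ℂ) φ),
      Integrable (fun p => inner ℝ (variation φ X p) (variation φ Y p)) area) ∧
    ∃ γ : ContMDiffRiemannianMetric 𝓘(ℝ, Fin (2 * n + 1) → ℂ) ∞ (Fin (2 * n + 1) → ℂ)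
        (fun φ : RationalMaps n => TangentSpace 𝓘(ℝ, Fin (2 * n + 1) → ℂ) φ),
      (∀ (φ : RationalMaps n) (X Y : TangentSpace 𝓘(ℝ, Fin (2 * n + 1) → ℂ) φ),
        γ.inner φ X Y = l2Inner φ X Y) ∧
      IsKaehler γ := by
  refine ⟨contMDiff_toMap, integrable_inner_variation, ?_⟩
  choose B hB using exists_clm_l2Inner (n := n)
  refine ⟨{ inner := B
            symm := fun φ X Y => by simp only [hB, l2Inner, real_inner_comm]
            pos := fun φ X hX => by rw [hB]; exact l2Inner_self_pos φ X hX
            isVonNBounded := fun φ => ?_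
            contMDiff := contMDiff_of_eq_l2Inner B hB }, hB, ?_, ?_⟩
  · exact isVonNBounded_of_pos (E := Fin (2 * n + 1) → ℂ) (B φ) fun X hX =>
      (l2Inner_self_pos φ X hX).trans_eq (hB φ X X).symm
  · intro φ X Y
    change B φ _ _ = B φ _ _
    rw [hB, hB, l2Inner_J]
  · intro e he
    obtain ⟨i, hi⟩ := exists_chart_index he
    obtain ⟨Ω, h1, h2⟩ := exists_closed_form i
    refine ⟨Ω, fun y hy v w => ?_, fun y hy => h2 y (hi y hy).1⟩
    change _ = B _ _ _
    rw [h1 y (hi y hy).1, hB, J_mfderiv_symm he hy, l2Inner_mfderiv_symm he hi hy]
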